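/- Let $\hat{\mathfrak{sl}}_2=\mathfrak{sl}_2\otimes\mathbb C[t,t^{-1}]\oplus\mathbb C K$ be the affine Lie algebra with $[x_m,y_n]=[x,y]_{m+n}+m\,\mathrm{tr}(xy)\,\delta_{m+n,0}K$, where $x_n=x\otimes t^n$ and $e,h,f$ is the standard basis of $\mathfrak{sl}_2$, and let $\mathcal L=\bigoplus_{s\in\mathbb Z}\mathbb C L_s\oplus\mathbb C C$ be the Virasoro algebra with $[L_m,L_n]=(m-n)L_{m+n}+\frac{m^3-m}{12}\delta_{m+n,0}C$. Let $k\in\mathbb C\setminus\{-2\}$ and $\mu,c\in\mathbb C$, and put $$h=\frac{\mu(3\mu+2-2k)}{4(k+2)}.$$ Let $M_k(\mu)$ be the Verma module of level $k$ for $\hat{\mathfrak{sl}}_2$, generated by a vector $v$ with $h_0v=\mu v$, $Kv=kv$, $e_0v=0$ and $x_nv=0$ for $x\in\mathfrak{sl}_2$, $n\ge 1$. Let $M^-_k(-\mu)$ be the lowest-weight Verma module, generated by a vector $v^-$ with $h_0v^-=-\mu v^-$, $Kv^-=kv^-$, $f_0v^-=0$ and $x_nv^-=0$ for $x\in\mathfrak{sl}_2$,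 $n\ge1$. Let $M_{\mathrm{Vir}}(c,h)$ be the Verma module for $\mathcal L$, generated by a vector $w$ with $L_0w=hw$, $Cw=cw$ and $L_sw=0$ for $s\ge1$. On the affine modules let $L_0$ be the Sugawara operator $$L_0=\frac{1}{2(k+2)}\Bigl(e_0f_0+f_0e_0+\tfrac12h_0^2+2\sum_{n\ge1}\bigl(e_{-n}f_n+f_{-n}e_n+\tfrac12h_{-n}h_n\bigr)\Bigr).$$ The vectors $\prod_{i\ge1}(e_{-i})^{k_i}(h_{-i})^{l_i}(f_{-i})^{m_i}(f_0)^nv$, where $(k_i),(l_i),(m_i)$ run over the finitely supported sequences in $\mathbb Z_{\ge0}$ and $n$ over $\mathbb Z_{\ge0}$, form a basis of $M_k(\mu)$ (factors with smaller $i$ stand to the left), and the linear map $\varphi^+\colon M_k(\mu)\to M_{\mathrm{Vir}}(c,h)$ with $$\prod_{i\ge1}(e_{-i})^{k_i}(h_{-i})^{l_i}(f_{-i})^{m_i}(f_0)^nv\ \longmapsto\ \prod_{i\ge1}(L_{-3i+1})^{k_i}(L_{-3i})^{l_i}(L_{-3i-1})^{m_i}(L_{-1})^nw$$ is an isomorphism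 of vector spaces. It maps vectors of $(h_0,L_0)$-weight $(f,n)$ to vectors of $L_0$-weight $-f/2+3n$. Likewise, the vectors $\prod_{i\ge1}(f_{-i})^{k_i}(h_{-i})^{l_i}(e_{-i})^{m_i}(e_0)^nv^-$ form a basis of $M^-_k(-\mu)$, and the linear map $\varphi^-\colon M^-_k(-\mu)\to M_{\mathrm{Vir}}(c,h)$ sending each of them to $\prod_{i\ge1}(L_{-3i+1})^{k_i}(L_{-3i})^{l_i}(L_{-3i-1})^{m_i}(L_{-1})^nw$ is an isomorphism of vector spaces. It maps vectors of $(h_0,L_0)$-weight $(f,n)$ to vectors of $L_0$-weight $f/2+3n$. On $M_k(\mu)$ and $M_k^-(-\mu)$ the operators $h_0,L_0$ are simultaneously diagonalisable with finite-dimensional joint eigenspaces, and on $M_{\mathrm{Vir}}(c,h)$ the operator $L_0$ is diagonalisable with finite-dimensional eigenspaces. The formal characters $\mathrm{ch}_M(w,q)=\mathrm{tr}_M\,q^{L_0}w^{h_0}$ and $\mathrm{ch}_M(q)=\mathrm{tr}_M\,q^{L_0}$ (formal sums of monomials with complex exponents) satisfy $$\mathrm{ch}_{M_k(\mu)}(q^{-1/2},q^3)=\mathrm{ch}_{M_{\mathrm{Vir}}(c,h)}(q)=\mathrm{ch}_{M^-_k(-\mu)}(q^{1/2},q^3),$$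 where both substitutions are well defined, i.e. only finitely many monomials contribute to each power of $q$. -/

import Mathlib

noncomputable section

open scoped TensorProduct

namespace AffVir

/-! ### The Lie algebra `sl₂` and its affinisation -/

/-- The complex Lie algebra `sl₂` of traceless `2 × 2` matrices. -/
abbrev Sl2 : Type := LieAlgebra.SpecialLinear.sl (Fin 2) ℂ

/-- `e` is the strictly upper triangular matrix unit. -/
def sl2E : Sl2 := ⟨!![0, 1; 0, 0], LinearMap.mem_ker.2 (by simp [Matrix.trace_fin_two])⟩

/-- `h = diag(1, -1)`. -/
def sl2H : Sl2 := ⟨!![1, 0; 0, -1], LinearMap.mem_ker.2 (by simp [Matrix.trace_fin_two])⟩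

/-- `f` is the strictly lower triangular matrix unit. -/
def sl2F : Sl2 := ⟨!![0, 0; 1, 0], LinearMap.mem_ker.2 (by simp [Matrix.trace_fin_two])⟩

/-- The normalised invariant form `(x, y) ↦ tr(xy)` on `sl₂`. -/
def sl2Form : LinearMap.BilinForm ℂ Sl2 :=
  LinearMap.mk₂ ℂ (fun x y => Matrix.trace (x.1 * y.1))
    (fun x y z => by simp [add_mul])
    (fun a x y => by simp)
    (fun x y z => by simp [mul_add])
    (fun a x y => by simp)

theorem sl2Form_apply (x y : Sl2) : sl2Form x y = Matrix.trace (x.1 * y.1) := rfl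

theorem neg_sl2Form_lieInvariant : (-sl2Form).lieInvariant Sl2 := by
  intro x y z
  simp only [LinearMap.neg_apply, sl2Form_apply, LieAlgebra.SpecialLinear.sl_bracket, sub_mul,
    mul_sub, Matrix.trace_sub, neg_sub]
  rw [Matrix.mul_assoc y.1 x.1 z.1, Matrix.mul_assoc x.1 y.1 z.1,
    Matrix.trace_mul_comm x.1 (y.1 * z.1), Matrix.mul_assoc]

theorem neg_sl2Form_isSymm : (-sl2Form).IsSymm :=
  ⟨fun x y => by
    simp only [LinearMap.neg_apply, sl2Form_apply]
    rw [Matrix.trace_mul_comm]⟩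

/-- The loop algebra `sl₂ ⊗ ℂ[t, t⁻¹]`. -/
abbrev LoopSl2 : Type := LieAlgebra.loopAlgebra ℂ ℤ Sl2

/-- The cocycle of the affine Lie algebra. Mathlib's cocycle attached to a form `Φ` sends
`(x tᵐ, y tⁿ)` to `n Φ(x, y) δ_{m+n,0}`, so that the form `-tr(xy)` gives the usual
`m tr(xy) δ_{m+n,0}`; see `lie_mode_mode`. -/
def affineCocycle : LieModule.Cohomology.twoCocycle ℂ LoopSl2 (TrivialLieModule ℂ LoopSl2 ℂ) :=
  LieAlgebra.LoopAlgebra.twoCocycleOfBilinear ℂ ℤ Sl2 (-sl2Form)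
    neg_sl2Form_lieInvariant neg_sl2Form_isSymm

/-- The affine Lie algebra `ŝl₂ = sl₂ ⊗ ℂ[t, t⁻¹] ⊕ ℂ K`. -/
abbrev AffineSl2 : Type := LieAlgebra.ofTwoCocycle affineCocycle

/-- The mode `xₙ = x ⊗ tⁿ`. -/
def mode (x : Sl2) (n : ℤ) : AffineSl2 :=
  LieAlgebra.ofProd affineCocycle (AddMonoidAlgebra.single n (1 : ℂ) ⊗ₜ[ℂ] x, 0)

/-- The central element `K`. -/
def centralK : AffineSl2 :=
  LieAlgebra.ofProd affineCocycle (0, (TrivialLieModule.equiv ℂ LoopSl2 ℂ).symm 1)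

theorem residuePairing_single (x y : Sl2) (m n : ℤ) :
    LieAlgebra.LoopAlgebra.residuePairing ℂ ℤ Sl2 (-sl2Form)
      (AddMonoidAlgebra.single m (1 : ℂ) ⊗ₜ[ℂ] x) (AddMonoidAlgebra.single n (1 : ℂ) ⊗ₜ[ℂ] y) =
      if m + n = 0 then (m : ℂ) * Matrix.trace (x.1 * y.1) else 0 := by
  rw [LieAlgebra.LoopAlgebra.residuePairing_apply_apply,
    LieAlgebra.LoopAlgebra.toFinsupp_single_tmul, LieAlgebra.LoopAlgebra.toFinsupp_single_tmul,
    Finsupp.sum_single_index (by simp)]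
  split_ifs with h
  · obtain rfl : n = -m := by omega
    rw [neg_neg, Finsupp.single_eq_same, LinearMap.neg_apply, LinearMap.neg_apply, sl2Form_apply,
      neg_smul, smul_neg, neg_neg, zsmul_eq_mul]
  · rw [Finsupp.single_eq_of_ne (by omega), map_zero, LinearMap.zero_apply, smul_zero]

/-- The commutation relation `[xₘ, yₙ] = [x, y]ₘ₊ₙ + m tr(xy) δ_{m+n,0} K`. -/
theorem lie_mode_mode (x y : Sl2) (m n : ℤ) :
    ⁅mode x m, mode y n⁆ =
      mode ⁅x, y⁆ (m + n) +
        (if m + n = 0 then (m : ℂ) * Matrix.trace (x.1 * y.1) else 0) • centralK := by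
  rw [mode, mode, LieAlgebra.bracket_ofTwoCocycle, mode, centralK, ← LieAlgebra.of_smul,
    ← LieAlgebra.of_add]
  congr 1
  refine Prod.ext ?_ ?_
  · rw [Prod.fst_add, Prod.smul_fst, smul_zero, add_zero]
    change ⁅AddMonoidAlgebra.single m (1 : ℂ) ⊗ₜ[ℂ] x, AddMonoidAlgebra.single n (1 : ℂ) ⊗ₜ[ℂ] y⁆ = _
    rw [LieAlgebra.ExtendScalars.bracket_tmul, AddMonoidAlgebra.single_mul_single, mul_one]
  · rw [Prod.snd_add, Prod.smul_snd, zero_add, ← residuePairing_single, ← map_smul, smul_eq_mul,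
      mul_one]
    simp only [trivial_lie_zero, add_zero, sub_zero]
    rfl

theorem lie_centralK (x : AffineSl2) : ⁅x, centralK⁆ = 0 := by
  rw [centralK, LieAlgebra.bracket_ofTwoCocycle, ← LieAlgebra.of_zero]
  congr 1
  simp [trivial_lie_zero]


/-! ### The Virasoro algebra -/

/-- The underlying vector space `⨁ₛ ℂ Lₛ ⊕ ℂ C` of the Virasoro algebra. -/
def Virasoro : Type := (ℤ →₀ ℂ) × ℂ

namespace Virasoro

instance : AddCommGroup Virasoro := inferInstanceAs (AddCommGroup ((ℤ →₀ ℂ) × ℂ))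

instance : Module ℂ Virasoro := inferInstanceAs (Module ℂ ((ℤ →₀ ℂ) × ℂ))

/-- The basis element `Lₛ`. -/
def L (s : ℤ) : Virasoro := ((Finsupp.single s 1, 0) : (ℤ →₀ ℂ) × ℂ)

/-- The central element `C`. -/
def C : Virasoro := ((0, 1) : (ℤ →₀ ℂ) × ℂ)

/-- The projection to the span of the `Lₛ`. -/
def fst : Virasoro →ₗ[ℂ] (ℤ →₀ ℂ) := LinearMap.fst ℂ (ℤ →₀ ℂ) ℂ

/-- The bracket on the span of the `Lₛ`, the bilinear extension of
`[Lₘ, Lₙ] = (m - n) Lₘ₊ₙ + (m³ - m)/12 δ_{m+n,0} C`. -/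
def bracketAux : (ℤ →₀ ℂ) →ₗ[ℂ] (ℤ →₀ ℂ) →ₗ[ℂ] Virasoro :=
  Finsupp.linearCombination ℂ fun m : ℤ => Finsupp.linearCombination ℂ fun n : ℤ =>
    ((m : ℂ) - n) • L (m + n) + (if m + n = 0 then ((m : ℂ) ^ 3 - m) / 12 else 0) • C

@[simp] theorem fst_L (s : ℤ) : fst (L s) = Finsupp.single s 1 := rfl

@[simp] theorem fst_C : fst C = 0 := rfl

theorem bracketAux_single (m n : ℤ) :
    bracketAux (Finsupp.single m 1) (Finsupp.single n 1) =
      ((m : ℂ) - n) • L (m + n) + (if m + n = 0 then ((m : ℂ) ^ 3 - m) / 12 else 0) • C := by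
  simp [bracketAux]

theorem bracketAux_skew (x y : ℤ →₀ ℂ) : bracketAux x y = -bracketAux y x := by
  have h : bracketAux = -bracketAux.flip := by
    ext m n : 4
    simp only [LinearMap.coe_comp, Function.comp_apply, Finsupp.lsingle_apply,
      LinearMap.neg_apply, LinearMap.flip_apply, bracketAux_single]
    rw [neg_add, ← neg_smul, ← neg_smul, add_comm n m]
    congr 2
    · ring
    · split_ifs with h
      · obtain rfl : n = -m := by omega
        push_cast; ring
      · simp
  exact LinearMap.congr_fun₂ h x y

theorem bracketAux_jacobi (x y z : ℤ →₀ ℂ) :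
    bracketAux x (fst (bracketAux y z)) =
      bracketAux (fst (bracketAux x y)) z + bracketAux y (fst (bracketAux x z)) := by
  induction x using Finsupp.induction_linear with
  | zero => simp
  | add x x' hx hx' => simp only [map_add, LinearMap.add_apply, hx, hx']; abel
  | single l a =>
  induction y using Finsupp.induction_linear with
  | zero => simp
  | add x x' hx hx' => simp only [map_add, hx, hx', LinearMap.add_apply]; abel
  | single m b =>
  induction z using Finsupp.induction_linear with
  | zero => simp
  | add x x' hx hx' => simp only [map_add, hx, hx']; abel
  | single n c =>
  have e (i : ℤ) (r : ℂ) : Finsupp.single i r = r • Finsupp.single i (1 : ℂ) := by simp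
  rw [e l a, e m b, e n c]
  simp only [map_smul, LinearMap.smul_apply, bracketAux_single, map_add, fst_L, fst_C, smul_zero,
    add_zero]
  rw [show l + (m + n) = l + m + n by ring, show m + (l + n) = l + m + n by ring]
  split_ifs with h
  · obtain rfl : n = -l - m := by omega
    push_cast
    module
  · push_cast
    module

theorem bracketAux_self (x : ℤ →₀ ℂ) : bracketAux x x = 0 := by
  have h : (2 : ℂ) • bracketAux x x = 0 := by
    rw [two_smul]
    nth_rewrite 1 [bracketAux_skew]
    exact neg_add_cancel _
  exact (smul_eq_zero.mp h).resolve_left two_ne_zero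

instance : LieRing Virasoro where
  bracket x y := bracketAux (fst x) (fst y)
  add_lie x y z := by simp
  lie_add x y z := by simp
  lie_self x := bracketAux_self (fst x)
  leibniz_lie x y z := bracketAux_jacobi (fst x) (fst y) (fst z)

instance : LieAlgebra ℂ Virasoro where
  lie_smul a x y := by
    change bracketAux (fst x) (fst (a • y)) = a • bracketAux (fst x) (fst y)
    simp

theorem lie_L_L (m n : ℤ) :
    ⁅L m, L n⁆ =
      ((m : ℂ) - n) • L (m + n) + (if m + n = 0 then ((m : ℂ) ^ 3 - m) / 12 else 0) • C :=
  bracketAux_single m n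

theorem lie_C (x : Virasoro) : ⁅x, C⁆ = 0 := by
  change bracketAux (fst x) (fst C) = 0
  simp

end Virasoro

/-! ### Modules and Verma modules -/

section Action

variable (g : Type) [LieRing g] [LieAlgebra ℂ g] (M : Type) [AddCommGroup M] [Module ℂ M]
  [Module (UniversalEnvelopingAlgebra ℂ g) M]
  [IsScalarTower ℂ (UniversalEnvelopingAlgebra ℂ g) M]

/-- The linear operator by which an element of the Lie algebra acts on a module over the universal
enveloping algebra. -/
def act (x : g) : Module.End ℂ M :=
  Algebra.lsmul ℂ ℂ M (UniversalEnvelopingAlgebra.ι ℂ x)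

variable {g} in
/-- The module generated by one vector `v` subject to the relations `x v = a v` for `(x, a) ∈ S`:
the quotient of the universal enveloping algebra by the left ideal generated by the elements
`x - a` with `(x, a) ∈ S`. -/
abbrev CyclicModule (S : Set (g × ℂ)) : Type :=
  UniversalEnvelopingAlgebra ℂ g ⧸
    Submodule.span (UniversalEnvelopingAlgebra ℂ g)
      ((fun p : g × ℂ => UniversalEnvelopingAlgebra.ι ℂ p.1 -
        algebraMap ℂ (UniversalEnvelopingAlgebra ℂ g) p.2) '' S)

variable {g} in
/-- The canonical generator of a cyclic module. -/
def CyclicModule.gen (S : Set (g × ℂ)) : CyclicModule S := Submodule.Quotient.mk 1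

end Action

/-- A module over the affine Lie algebra is smooth if every vector is annihilated by all modes `xₙ`
with `n` large enough. -/
class IsSmooth (M : Type) [AddCommGroup M] [Module ℂ M]
    [Module (UniversalEnvelopingAlgebra ℂ AffineSl2) M]
    [IsScalarTower ℂ (UniversalEnvelopingAlgebra ℂ AffineSl2) M] : Prop where
  eventually_zero : ∀ (x : Sl2) (v : M), ∃ N : ℕ, ∀ n : ℕ, N ≤ n → act AffineSl2 M (mode x n) v = 0

/-- The relations of the highest-weight vector of `M_k(μ)`: it is annihilated by `e₀` and by
`sl₂ ⊗ t ℂ[t]`, while `h₀` acts by `μ` and `K` by `k`. -/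
def highestRelations (k μ : ℂ) : Set (AffineSl2 × ℂ) :=
  {(centralK, k), (mode sl2H 0, μ), (mode sl2E 0, 0)} ∪
    {p | ∃ (x : Sl2) (n : ℕ), p = (mode x (n + 1), 0)}

/-- The relations of the lowest-weight vector of `M⁻_k(ν)`: it is annihilated by `f₀` and by
`sl₂ ⊗ t ℂ[t]`, while `h₀` acts by `ν` and `K` by `k`. -/
def lowestRelations (k ν : ℂ) : Set (AffineSl2 × ℂ) :=
  {(centralK, k), (mode sl2H 0, ν), (mode sl2F 0, 0)} ∪
    {p | ∃ (x : Sl2) (n : ℕ), p = (mode x (n + 1), 0)}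

/-- The Verma module `M_k(μ)` of level `k` and highest weight `μ` of the affine Lie algebra, induced
from the one-dimensional module `ℂ_μ` of the standard Borel subalgebra. -/
abbrev AffineVerma (k μ : ℂ) : Type := CyclicModule (highestRelations k μ)

/-- The lowest-weight Verma module `M⁻_k(ν)` of level `k` and lowest weight `ν`. -/
abbrev AffineVermaLowest (k ν : ℂ) : Type := CyclicModule (lowestRelations k ν)

/-- The relations of the highest-weight vector of `M_Vir(c, h)`: `Lₛ` with `s > 0` annihilates it,
`L₀` acts by `h` and `C` by `c`. -/
def virasoroRelations (c h : ℂ) : Set (Virasoro × ℂ) :=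
  {(Virasoro.C, c), (Virasoro.L 0, h)} ∪ {p | ∃ n : ℕ, p = (Virasoro.L (n + 1), 0)}

/-- The Verma module `M_Vir(c, h)` of the Virasoro algebra. -/
abbrev VirasoroVerma (c h : ℂ) : Type := CyclicModule (virasoroRelations c h)

/-- The affine Lie algebra is spanned by the modes and `K`. -/
theorem affine_induction {P : AffineSl2 → Prop} (hmode : ∀ x n, P (mode x n)) (hK : P centralK)
    (hadd : ∀ x y, P x → P y → P (x + y)) (hsmul : ∀ (a : ℂ) x, P x → P (a • x))
    (y : AffineSl2) : P y := by
  have h0 : P 0 := by simpa using hsmul 0 _ hK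
  have h1 : ∀ u : LoopSl2, P (LieAlgebra.ofProd affineCocycle (u, 0)) := by
    intro u
    induction u using TensorProduct.induction_on with
    | zero => exact h0
    | add u v hu hv =>
      have := hadd _ _ hu hv
      rwa [← LieAlgebra.of_add, Prod.mk_add_mk, add_zero] at this
    | tmul r x =>
      induction r using AddMonoidAlgebra.induction_linear with
      | zero => rw [TensorProduct.zero_tmul]; exact h0
      | add r s hr hs =>
        have := hadd _ _ hr hs
        rwa [← LieAlgebra.of_add, Prod.mk_add_mk, add_zero, ← TensorProduct.add_tmul] at this
      | single n a =>
        have := hsmul a _ (hmode x n)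
        rw [mode, ← LieAlgebra.of_smul, Prod.smul_mk, smul_zero, TensorProduct.smul_tmul'] at this
        rwa [AddMonoidAlgebra.smul_single, smul_eq_mul, mul_one] at this
  obtain ⟨u, a⟩ := y
  have h2 := hadd _ _ (h1 u) (hsmul (TrivialLieModule.equiv ℂ LoopSl2 ℂ a) _ hK)
  rw [centralK, ← LieAlgebra.of_smul, ← LieAlgebra.of_add, Prod.smul_mk, smul_zero, ← map_smul,
    smul_eq_mul, mul_one, LinearEquiv.symm_apply_apply, Prod.mk_add_mk, add_zero, zero_add] at h2
  exact h2

section Smooth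

attribute [local instance 100] LieRing.ofAssociativeRing

theorem universalEnveloping_induction {g : Type} [LieRing g] [LieAlgebra ℂ g]
    {P : UniversalEnvelopingAlgebra ℂ g → Prop} (halg : ∀ a : ℂ, P (algebraMap ℂ _ a))
    (hι : ∀ x : g, P (UniversalEnvelopingAlgebra.ι ℂ x)) (hadd : ∀ x y, P x → P y → P (x + y))
    (hmul : ∀ x y, P x → P y → P (x * y)) (u : UniversalEnvelopingAlgebra ℂ g) : P u := by
  let A : Subalgebra ℂ (UniversalEnvelopingAlgebra ℂ g) :=
    { carrier := {u | P u}
      mul_mem' := fun {x y} hx hy => hmul x y hx hy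
      add_mem' := fun {x y} hx hy => hadd x y hx hy
      algebraMap_mem' := halg }
  let j : g →ₗ⁅ℂ⁆ A :=
    { toFun := fun x => ⟨UniversalEnvelopingAlgebra.ι ℂ x, hι x⟩
      map_add' := fun x y => Subtype.ext (map_add _ x y)
      map_smul' := fun a x => Subtype.ext (map_smul _ a x)
      map_lie' := fun {x y} => Subtype.ext (LieHom.map_lie _ x y) }
  have h : A.val.comp (UniversalEnvelopingAlgebra.lift ℂ j) = AlgHom.id ℂ _ := by
    apply UniversalEnvelopingAlgebra.hom_ext
    ext x
    simp [j]
  have := (UniversalEnvelopingAlgebra.lift ℂ j u).2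
  have hu : ((UniversalEnvelopingAlgebra.lift ℂ j u : A) : UniversalEnvelopingAlgebra ℂ g) = u :=
    AlgHom.congr_fun h u
  rwa [hu] at this

theorem isSmooth_cyclicModule (S : Set (AffineSl2 × ℂ))
    (hS : ∀ (x : Sl2) (n : ℕ), (mode x (n + 1), (0 : ℂ)) ∈ S) : IsSmooth (CyclicModule S) := by
  have hact (z : AffineSl2) (v : CyclicModule S) :
      act AffineSl2 (CyclicModule S) z v = UniversalEnvelopingAlgebra.ι ℂ z • v := rfl
  let Q : CyclicModule S → Prop := fun v => ∀ x : Sl2, ∃ N : ℕ, ∀ n : ℕ, N ≤ n →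
    UniversalEnvelopingAlgebra.ι ℂ (mode x n) • v = 0
  have hQadd : ∀ v w, Q v → Q w → Q (v + w) := fun v w hv hw x => by
    obtain ⟨N₁, h₁⟩ := hv x
    obtain ⟨N₂, h₂⟩ := hw x
    exact ⟨N₁ + N₂, fun n hn => by
      rw [smul_add, h₁ n (by omega), h₂ n (by omega), add_zero]⟩
  have hcomm (z y : AffineSl2) (v : CyclicModule S) :
      UniversalEnvelopingAlgebra.ι ℂ z • UniversalEnvelopingAlgebra.ι ℂ y • v =
        UniversalEnvelopingAlgebra.ι ℂ y • UniversalEnvelopingAlgebra.ι ℂ z • v +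
          UniversalEnvelopingAlgebra.ι ℂ ⁅z, y⁆ • v := by
    rw [LieHom.map_lie, LieRing.of_associative_ring_bracket, sub_smul, mul_smul, mul_smul]
    abel
  have hQι : ∀ (y : AffineSl2) v, Q v → Q (UniversalEnvelopingAlgebra.ι ℂ y • v) := by
    intro y v hv
    induction y using affine_induction with
    | hadd y y' hy hy' => rw [map_add, add_smul]; exact hQadd _ _ hy hy'
    | hsmul a y hy =>
      intro x
      obtain ⟨N, h⟩ := hy x
      refine ⟨N, fun n hn => ?_⟩
      rw [map_smul, smul_assoc, smul_comm, h n hn, smul_zero]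
    | hK =>
      intro x
      obtain ⟨N, h⟩ := hv x
      refine ⟨N, fun n hn => ?_⟩
      rw [hcomm, lie_centralK, h n hn, smul_zero, map_zero, zero_smul, add_zero]
    | hmode y j =>
      intro x
      obtain ⟨N₁, h₁⟩ := hv x
      obtain ⟨N₂, h₂⟩ := hv ⁅x, y⁆
      refine ⟨N₁ + N₂ + j.natAbs + 1, fun n hn => ?_⟩
      have hpos : (n : ℤ) + j = ((n + j).toNat : ℕ) := by omega
      rw [hcomm, h₁ n (by omega), smul_zero, zero_add, lie_mode_mode, if_neg (by omega), zero_smul,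
        add_zero, hpos, h₂ _ (by omega)]
  have hQu : ∀ (u : UniversalEnvelopingAlgebra ℂ AffineSl2) v, Q v → Q (u • v) := by
    intro u
    induction u using universalEnveloping_induction with
    | halg a =>
      intro v hv x
      obtain ⟨N, h⟩ := hv x
      exact ⟨N, fun n hn => by rw [algebraMap_smul, smul_comm, h n hn, smul_zero]⟩
    | hι y => exact hQι y
    | hadd u u' hu hu' => intro v hv; rw [add_smul]; exact hQadd _ _ (hu v hv) (hu' v hv)
    | hmul u u' hu hu' => intro v hv; rw [mul_smul]; exact hu _ (hu' v hv)
  have hgen : Q (CyclicModule.gen S) := fun x => ⟨1, fun n hn => by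
    obtain ⟨n, rfl⟩ : ∃ m, n = m + 1 := ⟨n - 1, by omega⟩
    rw [CyclicModule.gen, ← Submodule.Quotient.mk_smul, Submodule.Quotient.mk_eq_zero]
    refine Submodule.subset_span ⟨_, hS x n, ?_⟩
    simp⟩
  refine ⟨fun x v => ?_⟩
  obtain ⟨u, rfl⟩ := Submodule.Quotient.mk_surjective _ v
  have h := hQu u _ hgen x
  rw [CyclicModule.gen, ← Submodule.Quotient.mk_smul, smul_eq_mul, mul_one] at h
  exact h

end Smooth

instance (k μ : ℂ) : IsSmooth (AffineVerma k μ) :=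
  isSmooth_cyclicModule _ fun x n => Or.inr ⟨x, n, rfl⟩

instance (k ν : ℂ) : IsSmooth (AffineVermaLowest k ν) :=
  isSmooth_cyclicModule _ fun x n => Or.inr ⟨x, n, rfl⟩

/-! ### The operator `L₀`, weight spaces and characters -/

section Affine

variable (k : ℂ) (M : Type) [AddCommGroup M] [Module ℂ M]
  [Module (UniversalEnvelopingAlgebra ℂ AffineSl2) M]
  [IsScalarTower ℂ (UniversalEnvelopingAlgebra ℂ AffineSl2) M]

/-- The operator `e₋ₙ fₙ + f₋ₙ eₙ + ½ h₋ₙ hₙ`. -/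
def sugawaraTerm (n : ℕ) : Module.End ℂ M :=
  act AffineSl2 M (mode sl2E (-n)) * act AffineSl2 M (mode sl2F n) +
    act AffineSl2 M (mode sl2F (-n)) * act AffineSl2 M (mode sl2E n) +
    (1 / 2 : ℂ) • (act AffineSl2 M (mode sl2H (-n)) * act AffineSl2 M (mode sl2H n))

variable [IsSmooth M]

theorem sugawaraTerm_finite (v : M) :
    (Function.support fun n : ℕ => sugawaraTerm M (n + 1) v).Finite := by
  obtain ⟨N₁, h₁⟩ := IsSmooth.eventually_zero sl2E v
  obtain ⟨N₂, h₂⟩ := IsSmooth.eventually_zero sl2F v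
  obtain ⟨N₃, h₃⟩ := IsSmooth.eventually_zero sl2H v
  refine (Set.finite_Iio (N₁ + N₂ + N₃)).subset fun n hn => ?_
  by_contra hlt
  rw [Set.mem_Iio, not_lt] at hlt
  refine hn ?_
  simp only [sugawaraTerm, LinearMap.add_apply, LinearMap.smul_apply, Module.End.mul_apply,
    h₁ (n + 1) (by omega), h₂ (n + 1) (by omega), h₃ (n + 1) (by omega), map_zero, smul_zero,
    add_zero]

/-- The Sugawara operator `L₀` on a smooth module of level `k ≠ -2`:
`L₀ = 1/(2(k+2)) (e₀f₀ + f₀e₀ + ½h₀² + 2 ∑_{n ≥ 1} (e₋ₙ fₙ + f₋ₙ eₙ + ½ h₋ₙ hₙ))`, where only finitely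
many terms of the sum do not annihilate a given vector. -/
def sugawaraL0 : Module.End ℂ M :=
  (1 / (2 * (k + 2))) •
    (sugawaraTerm M 0 + (2 : ℂ) •
      { toFun := fun v => ∑ᶠ n : ℕ, sugawaraTerm M (n + 1) v
        map_add' := fun v w => by
          simp only [map_add]
          exact finsum_add_distrib (sugawaraTerm_finite M v) (sugawaraTerm_finite M w)
        map_smul' := fun a v => by
          simp only [map_smul, RingHom.id_apply]
          exact (smul_finsum' a (sugawaraTerm_finite M v)).symm })

/-- The space of vectors of `(h₀, L₀)`-weight `(f, n)`. -/
def affineWeightSpace (f n : ℂ) : Submodule ℂ M :=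
  (act AffineSl2 M (mode sl2H 0)).eigenspace f ⊓ (sugawaraL0 k M).eigenspace n

/-- The Jacobi character `tr_M q^{L₀} w^{h₀}` is defined: `h₀` and `L₀` are simultaneously
diagonalisable with finite-dimensional simultaneous eigenspaces. -/
def HasAffineCharacter : Prop :=
  (⨆ p : ℂ × ℂ, affineWeightSpace k M p.1 p.2) = ⊤ ∧
    ∀ f n : ℂ, FiniteDimensional ℂ (affineWeightSpace k M f n)

/-- The Jacobi character `ch_M(w, q) = tr_M q^{L₀} w^{h₀}`, as the family of the coefficients of the
formal monomials `w^f q^n` with `f, n ∈ ℂ`. -/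
def affineCharacter : ℂ → ℂ → ℕ :=
  fun f n => Module.finrank ℂ (affineWeightSpace k M f n)

end Affine

section Vir

variable (M : Type) [AddCommGroup M] [Module ℂ M]
  [Module (UniversalEnvelopingAlgebra ℂ Virasoro) M]
  [IsScalarTower ℂ (UniversalEnvelopingAlgebra ℂ Virasoro) M]

/-- The space of vectors of `L₀`-weight `n`. -/
def virasoroWeightSpace (n : ℂ) : Submodule ℂ M :=
  (act Virasoro M (Virasoro.L 0)).eigenspace n

/-- The character `tr_M q^{L₀}` is defined: `L₀` is diagonalisable with finite-dimensional
eigenspaces. -/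
def HasVirasoroCharacter : Prop :=
  (⨆ n : ℂ, virasoroWeightSpace M n) = ⊤ ∧
    ∀ n : ℂ, FiniteDimensional ℂ (virasoroWeightSpace M n)

/-- The character `ch_M(q) = tr_M q^{L₀}`, as the family of the coefficients of the formal monomials
`q^n` with `n ∈ ℂ`. -/
def virasoroCharacter : ℂ → ℕ :=
  fun n => Module.finrank ℂ (virasoroWeightSpace M n)

end Vir

/-- The substitution `w ↦ q^a`, `q ↦ q^b` is defined for the formal sum `∑ ch f n • w^f q^n`: only
finitely many of its monomials contribute to any given power of `q`. -/
def CanSubstitute (ch : ℂ → ℂ → ℕ) (a b : ℂ) : Prop :=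
  ∀ m : ℂ, {p : ℂ × ℂ | a * p.1 + b * p.2 = m ∧ ch p.1 p.2 ≠ 0}.Finite

/-- The formal sum `ch(q^a, q^b)`: its coefficient at `q^m` is the sum of the coefficients of `ch` at
all monomials `w^f q^n` with `a f + b n = m`. -/
def substitute (ch : ℂ → ℂ → ℕ) (a b : ℂ) : ℂ → ℕ :=
  fun m => ∑ᶠ (p : ℂ × ℂ) (_ : a * p.1 + b * p.2 = m), ch p.1 p.2

/-! ### The Poincaré-Birkhoff-Witt monomials and the maps `φ⁺` and `φ⁻` -/

/-- The exponents of a monomial: finite sequences `(kᵢ)`, `(lᵢ)`, `(mᵢ)`, `i ≥ 1`, and a number `n`.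
The entry with index `i` of the sequences is stored at `i - 1`. -/
structure Exponents where
  /-- the exponents `kᵢ₊₁` -/
  k : ℕ →₀ ℕ
  /-- the exponents `lᵢ₊₁` -/
  l : ℕ →₀ ℕ
  /-- the exponents `mᵢ₊₁` -/
  m : ℕ →₀ ℕ
  /-- the last exponent -/
  n : ℕ

/-- A bound beyond which all exponents vanish. -/
def Exponents.bound (p : Exponents) : ℕ :=
  (p.k.support ∪ p.l.support ∪ p.m.support).sup Nat.succ

/-- The product `(∏_{i ≥ 0} X(i)^{kᵢ₊₁} Y(i)^{lᵢ₊₁} Z(i)^{mᵢ₊₁}) Wⁿ`, in which the factors with smaller `i`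
stand further to the left. -/
def orderedProduct {A : Type} [Ring A] (X Y Z : ℕ → A) (W : A) (p : Exponents) : A :=
  ((List.range p.bound).map fun i => X i ^ p.k i * Y i ^ p.l i * Z i ^ p.m i).prod * W ^ p.n

/-- The image of `xₙ` in the universal enveloping algebra of the affine Lie algebra. -/
def affineU (x : Sl2) (n : ℤ) : UniversalEnvelopingAlgebra ℂ AffineSl2 :=
  UniversalEnvelopingAlgebra.ι ℂ (mode x n)

/-- The image of `Lₛ` in the universal enveloping algebra of the Virasoro algebra. -/
def virasoroU (s : ℤ) : UniversalEnvelopingAlgebra ℂ Virasoro :=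
  UniversalEnvelopingAlgebra.ι ℂ (Virasoro.L s)

/-- The vector `∏_{i ≥ 1} (e₋ᵢ)^{kᵢ} (h₋ᵢ)^{lᵢ} (f₋ᵢ)^{mᵢ} (f₀)ⁿ v` of `M_k(μ)`. -/
def affineMonomial (k μ : ℂ) (p : Exponents) : AffineVerma k μ :=
  orderedProduct (fun i => affineU sl2E (-(i + 1))) (fun i => affineU sl2H (-(i + 1)))
    (fun i => affineU sl2F (-(i + 1))) (affineU sl2F 0) p • CyclicModule.gen (highestRelations k μ)

/-- The vector `∏_{i ≥ 1} (f₋ᵢ)^{kᵢ} (h₋ᵢ)^{lᵢ} (e₋ᵢ)^{mᵢ} (e₀)ⁿ v` of `M⁻_k(ν)`. -/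
def affineMonomialLowest (k ν : ℂ) (p : Exponents) : AffineVermaLowest k ν :=
  orderedProduct (fun i => affineU sl2F (-(i + 1))) (fun i => affineU sl2H (-(i + 1)))
    (fun i => affineU sl2E (-(i + 1))) (affineU sl2E 0) p • CyclicModule.gen (lowestRelations k ν)

/-- The vector `∏_{i ≥ 1} (L₋₃ᵢ₊₁)^{kᵢ} (L₋₃ᵢ)^{lᵢ} (L₋₃ᵢ₋₁)^{mᵢ} (L₋₁)ⁿ w` of `M_Vir(c, h)`. -/
def virasoroMonomial (c h : ℂ) (p : Exponents) : VirasoroVerma c h :=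
  orderedProduct (fun i => virasoroU (-3 * (i + 1) + 1)) (fun i => virasoroU (-3 * (i + 1)))
    (fun i => virasoroU (-3 * (i + 1) - 1)) (virasoroU (-1)) p •
      CyclicModule.gen (virasoroRelations c h)

end AffVir

end

/-!
All three Verma modules are induced from a character of a subalgebra, and the factors of the
monomials span a complement of that subalgebra. Letting the Lie algebra act on the symmetric algebra
of the complement, one factor at a time, shows that the ordered monomials are linearly independent,
so they form a basis.

These basis vectors are eigenvectors of `h₀` and `L₀`. For the Sugawara operator this follows from
`[L₀, x₋ₙ] = n x₋ₙ`: each of its terms commutes with the zero modes, as the Casimir element does,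
and the commutators of the terms with `h₋₁` telescope; brackets with `h₋₁` and `e₀` then yield all
`x₋ₙ`.

Finally, `e₋ᵢ`, `h₋ᵢ`, `f₋ᵢ`, `f₀` correspond to `L₋₃ᵢ₊₁`, `L₋₃ᵢ`, `L₋₃ᵢ₋₁`, `L₋₁`, and
`-α / 2 + 3 n` takes the `(h₀, L₀)`-weight `(α, n)` of each of them to the `L₀`-weight of its
counterpart. The value of `h` says that the same holds for the generators. Exchanging `e` and `f`
gives the lowest-weight case.
-/

noncomputable section

open scoped TensorProduct

namespace AffVir

section Monomials

variable {R σ : Type*} [CommRing R]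

variable (R σ) in
/-- The symmetric algebra of the free module on `σ`, as a module: a multiset stands for the product
of its elements. -/
abbrev Monomials : Type _ := Multiset σ →₀ R

variable (R) in
/-- The monomial attached to a multiset of variables. -/
abbrev mon (s : Multiset σ) : Monomials R σ := Finsupp.single s 1

variable (R σ) in
/-- The span of the monomials of degree less than `d`. -/
def degLT (d : ℕ) : Submodule R (Monomials R σ) :=
  Finsupp.supported R R {s : Multiset σ | s.card < d}

theorem mon_mem_degLT {s : Multiset σ} {d : ℕ} (h : s.card < d) : mon R s ∈ degLT R σ d :=
  Finsupp.single_mem_supported R 1 h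

theorem degLT_mono {d e : ℕ} (h : d ≤ e) : degLT R σ d ≤ degLT R σ e :=
  Finsupp.supported_mono fun _ hs => lt_of_lt_of_le hs h

theorem degLT_le_iff {d : ℕ} {W : Submodule R (Monomials R σ)} :
    degLT R σ d ≤ W ↔ ∀ s : Multiset σ, s.card < d → mon R s ∈ W := by
  rw [degLT, Finsupp.supported_eq_span_single, Submodule.span_le, Set.image_subset_iff]
  rfl

theorem eq_top_of_degLT_le {W : Submodule R (Monomials R σ)} (h : ∀ d, degLT R σ d ≤ W) :
    W = ⊤ := by
  rw [eq_top_iff, ← Finsupp.supported_univ, Finsupp.supported_eq_span_single, Submodule.span_le]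
  rintro _ ⟨s, -, rfl⟩
  exact h _ (mon_mem_degLT s.card.lt_succ_self)

/-- The product of a linear form in the variables and a polynomial. -/
def mulVar : (σ →₀ R) →ₗ[R] Monomials R σ →ₗ[R] Monomials R σ :=
  Finsupp.linearCombination R fun i => Finsupp.lmapDomain R R (i ::ₘ ·)

theorem mulVar_mon (a : σ →₀ R) (s : Multiset σ) :
    mulVar a (mon R s) = Finsupp.linearCombination R (fun i => mon R (i ::ₘ s)) a := by
  simp [mulVar, Finsupp.linearCombination_apply, Finsupp.sum, LinearMap.sum_apply]

@[simp] theorem mulVar_single (i : σ) (s : Multiset σ) :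
    mulVar (Finsupp.single i 1) (mon R s) = mon R (i ::ₘ s) := by
  rw [mulVar_mon, Finsupp.linearCombination_single, one_smul]

theorem mulVar_mon_mem {a : σ →₀ R} {s : Multiset σ} {W : Submodule R (Monomials R σ)}
    (h : ∀ i ∈ a.support, mon R (i ::ₘ s) ∈ W) : mulVar a (mon R s) ∈ W := by
  rw [mulVar_mon, Finsupp.linearCombination_apply]
  exact W.sum_mem fun i hi => W.smul_mem _ (h i hi)

theorem mulVar_mem_degLT (a : σ →₀ R) {d : ℕ} {v : Monomials R σ} (hv : v ∈ degLT R σ d) :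
    mulVar a v ∈ degLT R σ (d + 1) := by
  refine degLT_le_iff (W := (degLT R σ (d + 1)).comap (mulVar a)) |>.2 (fun s hs => ?_) hv
  exact mulVar_mon_mem fun i _ => mon_mem_degLT (by simpa using hs)

end Monomials

theorem multiset_min_induction {σ : Type*} [LinearOrder σ] {P : Multiset σ → Prop}
    (zero : P 0) (cons : ∀ (j : σ) (t : Multiset σ), (∀ i ∈ t, j ≤ i) → P (j ::ₘ t))
    (s : Multiset σ) : P s := by
  rw [← Multiset.sort_eq s (· ≤ ·)]
  have hs := Multiset.pairwise_sort s (· ≤ ·)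
  cases h : s.sort (· ≤ ·) with
  | nil => exact zero
  | cons j t =>
    rw [h, List.pairwise_cons] at hs
    exact cons j t fun i hi => hs.1 i hi

theorem forall_mem_cons_le {σ : Type*} [Preorder σ] {i k : σ} {t : Multiset σ} (hik : i ≤ k)
    (h : ∀ j ∈ t, k ≤ j) : ∀ j ∈ k ::ₘ t, i ≤ j :=
  Multiset.forall_mem_cons.2 ⟨hik, fun j hj => hik.trans (h j hj)⟩

section MonomialAction

variable {R σ L : Type*} [CommRing R] [LinearOrder σ] [LieRing L] [LieAlgebra R L]
  (x : σ → L) (π : L →ₗ[R] σ →₀ R) (χ : L →ₗ[R] R)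

/-- The projection of `L` along the variables `xᵢ` with `i ≤ j`. -/
def trunc (j : σ) : L →ₗ[R] L :=
  LinearMap.id - (Finsupp.linearCombination R fun i => if i ≤ j then x i else 0) ∘ₗ π

theorem map_trunc {W : Type*} [AddCommGroup W] [Module R W] {j : σ} {f : L →ₗ[R] W}
    (h : ∀ i ≤ j, f (x i) = 0) (y : L) : f (trunc x π j y) = f y := by
  have hf : (fun i => f (if i ≤ j then x i else 0)) = 0 := by
    funext i
    split_ifs with hi
    exacts [h i hi, map_zero f]
  rw [trunc, LinearMap.sub_apply, map_sub, LinearMap.comp_apply, Finsupp.apply_linearCombination,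
    Function.comp_def, hf]
  simp

/-- One step of the recursion for `corr`. -/
def corrStep (c : L →ₗ[R] Monomials R σ →ₗ[R] Monomials R σ) :
    L →ₗ[R] Monomials R σ →ₗ[R] Monomials R σ :=
  LinearMap.flip <| Finsupp.linearCombination R fun s : Multiset σ =>
    match s.sort (· ≤ ·) with
    | [] => χ.smulRight (mon R 0)
    | j :: t =>
      ((mulVar ∘ₗ π + c) (x j) ∘ₗ c.flip (mon R (t : Multiset σ)) +
        (mulVar ∘ₗ π + c).flip (mon R (t : Multiset σ)) ∘ₗ
          (LieModule.toEnd R L L : L →ₗ[R] Module.End R L).flip (x j)) ∘ₗ trunc x π j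

/-- The difference between the action `monAct` and the multiplication by `π`. It does not raise the
degree, so it can be defined by recursion on the degree: `corr d` is correct on monomials of degree
less than `d`. -/
def corr : ℕ → L →ₗ[R] Monomials R σ →ₗ[R] Monomials R σ
  | 0 => 0
  | d + 1 => corrStep x π χ (corr d)

theorem corrStep_zero (c : L →ₗ[R] Monomials R σ →ₗ[R] Monomials R σ) (y : L) :
    corrStep x π χ c y (mon R 0) = χ y • mon R 0 := by
  rw [corrStep, LinearMap.flip_apply, Finsupp.linearCombination_single, one_smul,
    Multiset.sort_zero]
  rfl

theorem corrStep_cons (c : L →ₗ[R] Monomials R σ →ₗ[R] Monomials R σ) (y : L) {j : σ}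
    {t : Multiset σ} (h : ∀ i ∈ t, j ≤ i) :
    corrStep x π χ c y (mon R (j ::ₘ t)) =
      mulVar (π (x j)) (c (trunc x π j y) (mon R t)) + c (x j) (c (trunc x π j y) (mon R t)) +
        (mulVar (π ⁅trunc x π j y, x j⁆) (mon R t) + c ⁅trunc x π j y, x j⁆ (mon R t)) := by
  rw [corrStep, LinearMap.flip_apply, Finsupp.linearCombination_single, one_smul,
    Multiset.sort_cons _ _ _ h]
  simp [Multiset.sort_eq]

theorem corr_mem_degLT (d : ℕ) (y : L) {n : ℕ} {v : Monomials R σ} (hv : v ∈ degLT R σ n) :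
    corr x π χ d y v ∈ degLT R σ n := by
  induction d generalizing y n v with
  | zero => simp [corr]
  | succ d ih =>
    refine degLT_le_iff (W := (degLT R σ n).comap (corr x π χ (d + 1) y)) |>.2 (fun s => ?_) hv
    rw [Submodule.mem_comap, corr]
    induction s using multiset_min_induction with
    | zero =>
      intro hs
      rw [corrStep_zero]
      exact Submodule.smul_mem _ _ (mon_mem_degLT hs)
    | cons j t h =>
      intro hs
      rw [Multiset.card_cons] at hs
      obtain ⟨n, rfl⟩ : ∃ m, n = m + 1 := ⟨n - 1, by omega⟩
      have ht : mon R t ∈ degLT R σ n := mon_mem_degLT (by omega)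
      have ht' : mon R t ∈ degLT R σ (n + 1) := degLT_mono n.le_succ ht
      rw [corrStep_cons x π χ _ y h]
      exact add_mem (add_mem (mulVar_mem_degLT _ (ih _ ht)) (ih _ (ih _ ht')))
        (add_mem (mulVar_mem_degLT _ ht) (ih _ ht'))

theorem corr_succ_apply (d : ℕ) (y : L) {v : Monomials R σ} (hv : v ∈ degLT R σ d) :
    corr x π χ (d + 1) y v = corr x π χ d y v := by
  induction d generalizing y v with
  | zero =>
    have hv0 : v = 0 := by simpa [degLT] using hv
    simp [hv0]
  | succ d ih =>
    refine degLT_le_iff (W := LinearMap.eqLocus (corr x π χ (d + 2) y) (corr x π χ (d + 1) y))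
      |>.2 (fun s => ?_) hv
    change s.card < d + 1 → corrStep x π χ (corr x π χ (d + 1)) y (mon R s) =
      corrStep x π χ (corr x π χ d) y (mon R s)
    induction s using multiset_min_induction with
    | zero => intro; rw [corrStep_zero, corrStep_zero]
    | cons j t h =>
      intro hs
      rw [Multiset.card_cons] at hs
      have ht : mon R t ∈ degLT R σ d := mon_mem_degLT (by omega)
      rw [corrStep_cons x π χ _ y h, corrStep_cons x π χ _ y h, ih _ ht, ih _ ht,
        ih _ (corr_mem_degLT x π χ _ _ ht)]

theorem corr_eq_of_le {d e : ℕ} (h : d ≤ e) (y : L) {v : Monomials R σ} (hv : v ∈ degLT R σ d) :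
    corr x π χ e y v = corr x π χ d y v := by
  induction e, h using Nat.le_induction with
  | base => rfl
  | succ e he ih => rw [corr_succ_apply x π χ e y (degLT_mono he hv), ih]

/-- The action of `L` on monomials which makes them a model of the module induced from the
character `χ` of `ker π`: it is forced by letting `xᵢ` multiply a monomial in variables `xⱼ`,
`j ≥ i`, and moving any other element past the smallest variable of a monomial; see
`monAct_cons`. -/
def monAct : L →ₗ[R] Module.End R (Monomials R σ) :=
  mulVar ∘ₗ π + LinearMap.flip (Finsupp.linearCombination R fun s : Multiset σ =>
    (corr x π χ (s.card + 1)).flip (mon R s))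

theorem monAct_eq_of_mem (d : ℕ) (y : L) {v : Monomials R σ} (hv : v ∈ degLT R σ d) :
    monAct x π χ y v = mulVar (π y) v + corr x π χ d y v := by
  refine degLT_le_iff (W := LinearMap.eqLocus (monAct x π χ y) (mulVar (π y) + corr x π χ d y))
    |>.2 (fun s hs => ?_) hv
  simp only [monAct, LinearMap.mem_eqLocus, LinearMap.add_apply, LinearMap.coe_comp,
    Function.comp_apply, LinearMap.flip_apply, Finsupp.linearCombination_single, one_smul]
  rw [corr_eq_of_le x π χ (show s.card + 1 ≤ d from hs) y (mon_mem_degLT s.card.lt_succ_self)]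

theorem monAct_sub_mulVar_mem (d : ℕ) (y : L) {v : Monomials R σ} (hv : v ∈ degLT R σ d) :
    monAct x π χ y v - mulVar (π y) v ∈ degLT R σ d := by
  rw [monAct_eq_of_mem x π χ d y hv, add_sub_cancel_left]
  exact corr_mem_degLT x π χ d y hv

theorem monAct_zero (y : L) :
    monAct x π χ y (mon R 0) = mulVar (π y) (mon R 0) + χ y • mon R 0 := by
  rw [monAct_eq_of_mem x π χ 1 y (mon_mem_degLT (by simp)), corr, corrStep_zero]

theorem monAct_cons (y : L) {j : σ} {t : Multiset σ} (h : ∀ i ∈ t, j ≤ i) :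
    monAct x π χ y (mon R (j ::ₘ t)) = mulVar (π y) (mon R (j ::ₘ t)) +
      (monAct x π χ (x j) (monAct x π χ (trunc x π j y) (mon R t) -
        mulVar (π (trunc x π j y)) (mon R t)) +
        monAct x π χ ⁅trunc x π j y, x j⁆ (mon R t)) := by
  have ht : mon R t ∈ degLT R σ (t.card + 1) := mon_mem_degLT t.card.lt_succ_self
  rw [monAct_eq_of_mem x π χ (t.card + 1 + 1) y (mon_mem_degLT (by simp)), corr,
    corrStep_cons x π χ _ y h,
    monAct_eq_of_mem x π χ (t.card + 1) (x j) (monAct_sub_mulVar_mem x π χ _ _ ht),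
    monAct_eq_of_mem x π χ (t.card + 1) _ ht,
    monAct_eq_of_mem x π χ (t.card + 1) _ ht, add_sub_cancel_left]

end MonomialAction

section LieDefect

attribute [local instance 100] LieRing.ofAssociativeRing

variable {R L V : Type*} [CommRing R] [LieRing L] [LieAlgebra R L] [AddCommGroup V] [Module R V]
  (ρ : L →ₗ[R] Module.End R V)

/-- The failure of a linear map `L → End V` to be a homomorphism of Lie algebras. -/
def lieDefect : L →ₗ[R] L →ₗ[R] Module.End R V :=
  LinearMap.mk₂ R (fun y z => ⁅ρ y, ρ z⁆ - ρ ⁅y, z⁆)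
    (fun y y' z => by simp only [map_add, add_lie]; abel)
    (fun a y z => by simp only [map_smul, smul_lie, smul_sub])
    (fun y z z' => by simp only [map_add, lie_add]; abel)
    (fun a y z => by simp only [map_smul, lie_smul, smul_sub])

theorem lieDefect_def (y z : L) : lieDefect ρ y z = ⁅ρ y, ρ z⁆ - ρ ⁅y, z⁆ := rfl

theorem lieDefect_apply (y z : L) (v : V) :
    lieDefect ρ y z v = ρ y (ρ z v) - ρ z (ρ y v) - ρ ⁅y, z⁆ v := rfl

theorem lieDefect_swap (y z : L) : lieDefect ρ y z = -lieDefect ρ z y := by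
  rw [lieDefect_def, lieDefect_def, ← lie_skew (ρ y), ← lie_skew y, map_neg]
  abel

theorem lieDefect_self (y : L) : lieDefect ρ y y = 0 := by
  rw [lieDefect_def, lie_self, lie_self, map_zero, sub_zero]

/-- The Bianchi identity, `lieDefect` being the curvature of `ρ`. -/
theorem lieDefect_bianchi (a b c : L) :
    ⁅ρ a, lieDefect ρ b c⁆ + ⁅ρ b, lieDefect ρ c a⁆ + ⁅ρ c, lieDefect ρ a b⁆ +
      (lieDefect ρ a ⁅b, c⁆ + lieDefect ρ b ⁅c, a⁆ + lieDefect ρ c ⁅a, b⁆) = 0 := by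
  have hL := congrArg ρ (lie_jacobi a b c)
  simp only [map_add, map_zero] at hL
  simp only [lieDefect_def, lie_sub]
  rw [← sub_eq_zero.2 ((lie_jacobi (ρ a) (ρ b) (ρ c)).trans hL.symm)]
  abel

theorem lieDefect_apply_apply_eq_zero {a b c : L} {v : V} (hv : ∀ y z, lieDefect ρ y z v = 0)
    (ha : lieDefect ρ b c (ρ a v) = 0) (hb : lieDefect ρ c a (ρ b v) = 0) :
    lieDefect ρ a b (ρ c v) = 0 := by
  have h := LinearMap.congr_fun (lieDefect_bianchi ρ a b c) v
  simpa only [LieRing.of_associative_ring_bracket, LinearMap.add_apply, LinearMap.sub_apply,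
    Module.End.mul_apply, hv, ha, hb, map_zero, zero_sub, sub_zero, zero_add, add_zero, neg_eq_zero,
    LinearMap.zero_apply] using h

end LieDefect

section Induced

attribute [local instance 100] LieRing.ofAssociativeRing

variable {R σ L : Type*} [CommRing R] [LieRing L] [LieAlgebra R L]

/-- The relations `y v = a v`, `(y, a) ∈ S`, come from the character `χ` of the subalgebra `ker π`,
to which the span of the variables `xᵢ`, with coordinates `π`, is complementary. -/
structure IsInduced (x : σ → L) (π : L →ₗ[R] σ →₀ R) (χ : L →ₗ[R] R) (S : Set (L × R)) : Prop where
  coord_var : ∀ i, π (x i) = Finsupp.single i 1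
  coord_rel : ∀ p ∈ S, π p.1 = 0
  char_rel : ∀ p ∈ S, χ p.1 = p.2
  char_var : ∀ i, χ (x i) = 0
  coord_lie : ∀ p ∈ S, ∀ q ∈ S, π ⁅p.1, q.1⁆ = 0
  char_lie : ∀ p ∈ S, ∀ q ∈ S, χ ⁅p.1, q.1⁆ = 0
  span_eq_top : Submodule.span R (Set.range x ∪ Prod.fst '' S) = ⊤

namespace IsInduced

variable {x : σ → L} {π : L →ₗ[R] σ →₀ R} {χ : L →ₗ[R] R} {S : Set (L × R)}
  (H : IsInduced x π χ S)

include H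

theorem hom_eq_zero {W : Type*} [AddCommGroup W] [Module R W] {f : L →ₗ[R] W}
    (hvar : ∀ i, f (x i) = 0) (hrel : ∀ p ∈ S, f p.1 = 0) : f = 0 := by
  refine LinearMap.ext_on H.span_eq_top ?_
  rintro _ (⟨i, rfl⟩ | ⟨p, hp, rfl⟩)
  exacts [hvar i, hrel p hp]

variable [LinearOrder σ]

theorem coord_trunc (j : σ) (y : L) : π (trunc x π j y) = (π y).filter (j < ·) := by
  have project (a : σ →₀ R) :
      a - Finsupp.linearCombination R (fun i => π (if i ≤ j then x i else 0)) a =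
        a.filter (j < ·) := by
    induction a using Finsupp.induction_linear with
    | zero => rw [map_zero, Finsupp.filter_zero, sub_zero]
    | add a b ha hb => rw [map_add, Finsupp.filter_add, ← ha, ← hb]; abel
    | single i r =>
      rw [Finsupp.linearCombination_single, apply_ite π, H.coord_var, map_zero]
      rcases le_or_gt i j with hij | hij
      · rw [if_pos hij, Finsupp.filter_single_of_neg _ hij.not_gt, Finsupp.smul_single_one,
          sub_self]
      · rw [if_neg hij.not_ge, Finsupp.filter_single_of_pos _ hij, smul_zero, sub_zero]
  rw [← project, trunc, LinearMap.sub_apply, map_sub, LinearMap.comp_apply,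
    Finsupp.apply_linearCombination]
  rfl

theorem trunc_var {i j : σ} (hij : i ≤ j) : trunc x π j (x i) = 0 := by
  rw [trunc, LinearMap.sub_apply, LinearMap.comp_apply, H.coord_var,
    Finsupp.linearCombination_single, one_smul, if_pos hij, LinearMap.id_apply, sub_self]

theorem monAct_var {i : σ} {s : Multiset σ} (h : ∀ j ∈ s, i ≤ j) :
    monAct x π χ (x i) (mon R s) = mon R (i ::ₘ s) := by
  induction s using multiset_min_induction with
  | zero => rw [monAct_zero, H.coord_var, mulVar_single, H.char_var, zero_smul, add_zero]
  | cons j t ht =>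
    rw [monAct_cons x π χ _ ht, H.trunc_var (h j (Multiset.mem_cons_self _ _)), H.coord_var,
      mulVar_single]
    simp

theorem monAct_var_mulVar {j : σ} {a : σ →₀ R} {s : Multiset σ} (ha : ∀ i ∈ a.support, j ≤ i)
    (h : ∀ i ∈ s, j ≤ i) :
    monAct x π χ (x j) (mulVar a (mon R s)) = mulVar a (mon R (j ::ₘ s)) := by
  rw [mulVar_mon, mulVar_mon, Finsupp.apply_linearCombination]
  refine Finsupp.sum_congr fun i hi => ?_
  simp only [LinearMap.smulRight_apply, Function.comp_apply, Multiset.cons_swap i j,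
    H.monAct_var (Multiset.forall_mem_cons.2 ⟨ha i hi, h⟩)]

theorem lt_of_mem_support_coord_trunc {i k : σ} {y : L}
    (hi : i ∈ (π (trunc x π k y)).support) : k < i := by
  rw [H.coord_trunc, Finsupp.support_filter, Finset.mem_filter] at hi
  exact hi.2

theorem monAct_trunc_mem {W : Submodule R (Monomials R σ)} {k : σ} {t : Multiset σ}
    (hdeg : degLT R σ (t.card + 1) ≤ W) (hcons : ∀ i, k < i → mon R (i ::ₘ t) ∈ W) (y : L) :
    monAct x π χ (trunc x π k y) (mon R t) ∈ W := by
  rw [← sub_add_cancel (monAct x π χ (trunc x π k y) (mon R t))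
    (mulVar (π (trunc x π k y)) (mon R t))]
  exact add_mem (hdeg (monAct_sub_mulVar_mem x π χ _ _ (mon_mem_degLT t.card.lt_succ_self)))
    (mulVar_mon_mem fun i hi => hcons i (H.lt_of_mem_support_coord_trunc hi))

theorem lieDefect_trunc_var {j : σ} {s : Multiset σ} (h : ∀ i ∈ s, j ≤ i) (y : L) :
    lieDefect (monAct x π χ) (trunc x π j y) (x j) (mon R s) = 0 := by
  have htrunc : trunc x π j (trunc x π j y) = trunc x π j y :=
    map_trunc x π (fun _ hi => H.trunc_var hi) y
  rw [lieDefect_apply, H.monAct_var h, monAct_cons x π χ _ h, htrunc, map_sub,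
    H.monAct_var_mulVar (fun i hi => (H.lt_of_mem_support_coord_trunc hi).le) h]
  abel

theorem lieDefect_var_right (y : L) {j : σ} {s : Multiset σ} (h : ∀ i ∈ s, j ≤ i) :
    lieDefect (monAct x π χ) y (x j) (mon R s) = 0 := by
  have hvar {i : σ} (hij : i ≤ j) : lieDefect (monAct x π χ) (x i) (x j) (mon R s) = 0 := by
    rcases hij.eq_or_lt with rfl | hlt
    · rw [lieDefect_self, LinearMap.zero_apply]
    · have htrunc : trunc x π i (x j) = x j := by
        simp [trunc, H.coord_var, hlt.not_ge]
      rw [lieDefect_swap, LinearMap.neg_apply, ← htrunc,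
        H.lieDefect_trunc_var (fun k hk => hij.trans (h k hk)), neg_zero]
  rw [← H.lieDefect_trunc_var h y]
  exact (map_trunc x π (f := LinearMap.applyₗ (mon R s) ∘ₗ (lieDefect (monAct x π χ)).flip (x j))
    (fun i hij => hvar hij) y).symm

theorem lieDefect_var_left (y : L) {j : σ} {s : Multiset σ} (h : ∀ i ∈ s, j ≤ i) :
    lieDefect (monAct x π χ) (x j) y (mon R s) = 0 := by
  rw [lieDefect_swap, LinearMap.neg_apply, H.lieDefect_var_right y h, neg_zero]

theorem lieDefect_mon_zero (y z : L) : lieDefect (monAct x π χ) y z (mon R 0) = 0 := by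
  have hvar (i : σ) (y : L) : lieDefect (monAct x π χ) y (x i) (mon R 0) = 0 :=
    H.lieDefect_var_right y (by simp)
  have hrel {p q : L × R} (hp : p ∈ S) (hq : q ∈ S) :
      lieDefect (monAct x π χ) p.1 q.1 (mon R 0) = 0 := by
    simp only [lieDefect_apply, monAct_zero, H.coord_rel p hp, H.coord_rel q hq,
      H.coord_lie p hp q hq, H.char_lie p hp q hq, map_zero, LinearMap.zero_apply, zero_add,
      map_smul, zero_smul, sub_zero]
    rw [smul_comm, sub_self]
  have hright {p : L × R} (hp : p ∈ S) :
      LinearMap.applyₗ (mon R 0) ∘ₗ lieDefect (monAct x π χ) p.1 = 0 :=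
    H.hom_eq_zero (hvar · p.1) fun _ hq => hrel hp hq
  have hleft : LinearMap.applyₗ (mon R 0) ∘ₗ (lieDefect (monAct x π χ)).flip z = 0 :=
    H.hom_eq_zero (fun i => H.lieDefect_var_left z (by simp))
      fun _ hp => LinearMap.congr_fun (hright hp) z
  exact LinearMap.congr_fun hleft y

theorem lieDefect_trunc_cons {k : σ} {t : Multiset σ} (h : ∀ i ∈ t, k ≤ i)
    (ih : ∀ a b, degLT R σ (t.card + 1) ≤ LinearMap.ker (lieDefect (monAct x π χ) a b)) (y z : L) :
    lieDefect (monAct x π χ) (trunc x π k y) (trunc x π k z) (mon R (k ::ₘ t)) = 0 := by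
  have hcons (i : σ) (hki : k < i) : ∀ j ∈ i ::ₘ t, k ≤ j :=
    Multiset.forall_mem_cons.2 ⟨hki.le, h⟩
  rw [← H.monAct_var h]
  exact lieDefect_apply_apply_eq_zero _ (fun a b => ih a b (mon_mem_degLT t.card.lt_succ_self))
    (LinearMap.mem_ker.1 <| H.monAct_trunc_mem (ih _ _)
      (fun i hki => H.lieDefect_var_right _ (hcons i hki)) y)
    (LinearMap.mem_ker.1 <| H.monAct_trunc_mem (ih _ _)
      (fun i hki => H.lieDefect_var_left _ (hcons i hki)) z)

theorem degLT_le_ker_lieDefect (d : ℕ) (y z : L) :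
    degLT R σ d ≤ LinearMap.ker (lieDefect (monAct x π χ) y z) := by
  induction d generalizing y z with
  | zero => exact degLT_le_iff.2 fun s hs => absurd hs s.card.not_lt_zero
  | succ d ih =>
    refine degLT_le_iff.2 fun s hs => ?_
    rw [LinearMap.mem_ker]
    induction s using multiset_min_induction with
    | zero => exact H.lieDefect_mon_zero y z
    | cons k t h =>
      have hle {i : σ} (hik : i ≤ k) := forall_mem_cons_le hik h
      have hdeg : degLT R σ (t.card + 1) ≤ degLT R σ d :=
        degLT_mono (by rw [Multiset.card_cons] at hs; omega)
      have hleft := map_trunc x π (j := k)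
        (f := LinearMap.applyₗ (mon R (k ::ₘ t)) ∘ₗ (lieDefect (monAct x π χ)).flip z)
        (fun i hik => H.lieDefect_var_left z (hle hik)) y
      have hright := map_trunc x π (j := k)
        (f := LinearMap.applyₗ (mon R (k ::ₘ t)) ∘ₗ lieDefect (monAct x π χ) (trunc x π k y))
        (fun i hik => H.lieDefect_var_right _ (hle hik)) z
      exact hleft.symm.trans <| hright.symm.trans <|
        H.lieDefect_trunc_cons h (fun a b => hdeg.trans (ih a b)) y z

theorem lieDefect_monAct (y z : L) : lieDefect (monAct x π χ) y z = 0 :=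
  LinearMap.ker_eq_top.1 <| eq_top_of_degLT_le fun d => H.degLT_le_ker_lieDefect d y z

/-- The module induced from the character `χ`, modelled on monomials. -/
def rep : L →ₗ⁅R⁆ Module.End R (Monomials R σ) :=
  { monAct x π χ with
    map_lie' := fun {y z} => (sub_eq_zero.1 (H.lieDefect_monAct y z)).symm }

theorem rep_apply (y : L) (v : Monomials R σ) : H.rep y v = monAct x π χ y v := rfl

end IsInduced

variable [LinearOrder σ] (x : σ → L) {V : Type*} [AddCommGroup V] [Module R V]
  (ρ : L →ₗ⁅R⁆ Module.End R V) (v : V)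

/-- The linear map sending a monomial to the vector `xᵢ₁ ⋯ xᵢₙ v` with `i₁ ≤ ⋯ ≤ iₙ`. -/
def orderedMonomials : Monomials R σ →ₗ[R] V :=
  Finsupp.linearCombination R fun s =>
    ((s.sort (· ≤ ·)).map fun i => ρ (x i)).prod v

theorem orderedMonomials_mon (s : Multiset σ) :
    orderedMonomials x ρ v (mon R s) = ((s.sort (· ≤ ·)).map fun i => ρ (x i)).prod v := by
  rw [orderedMonomials, Finsupp.linearCombination_single, one_smul]

theorem orderedMonomials_zero : orderedMonomials x ρ v (mon R 0) = v := by
  rw [orderedMonomials_mon, Multiset.sort_zero, List.map_nil, List.prod_nil, Module.End.one_apply]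

theorem orderedMonomials_cons {j : σ} {t : Multiset σ} (h : ∀ i ∈ t, j ≤ i) :
    orderedMonomials x ρ v (mon R (j ::ₘ t)) = ρ (x j) (orderedMonomials x ρ v (mon R t)) := by
  rw [orderedMonomials_mon, orderedMonomials_mon, Multiset.sort_cons _ _ _ h, List.map_cons,
    List.prod_cons, Module.End.mul_apply]

namespace IsInduced

variable {x} {π : L →ₗ[R] σ →₀ R} {χ : L →ₗ[R] R} {S : Set (L × R)} (H : IsInduced x π χ S)

theorem orderedMonomials_rep : orderedMonomials x H.rep (mon R 0) = LinearMap.id := by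
  refine Finsupp.lhom_ext' fun s => LinearMap.ext_ring ?_
  change orderedMonomials x H.rep (mon R 0) (mon R s) = mon R s
  induction hn : s.card generalizing s with
  | zero => rw [Multiset.card_eq_zero.1 hn, orderedMonomials_zero]
  | succ n ih =>
    induction s using multiset_min_induction with
    | zero => simp at hn
    | cons j t h =>
      rw [orderedMonomials_cons x _ _ h, ih t (by simpa using hn), rep_apply, H.monAct_var h]

include H

variable {ρ v}

theorem orderedMonomials_monAct_cons {k : σ} {t : Multiset σ} (h : ∀ i ∈ t, k ≤ i)
    (ih : ∀ y, ∀ w ∈ degLT R σ (t.card + 1),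
      orderedMonomials x ρ v (monAct x π χ y w) = ρ y (orderedMonomials x ρ v w)) (y : L) :
    orderedMonomials x ρ v (monAct x π χ y (mon R (k ::ₘ t))) =
      ρ y (orderedMonomials x ρ v (mon R (k ::ₘ t))) := by
  set F := orderedMonomials x ρ v
  have hvar {i : σ} {s : Multiset σ} (hi : ∀ j ∈ s, i ≤ j) :
      F (monAct x π χ (x i) (mon R s)) = ρ (x i) (F (mon R s)) := by
    rw [H.monAct_var hi]
    exact orderedMonomials_cons x ρ v hi
  have hk : F (monAct x π χ (x k) (monAct x π χ (trunc x π k y) (mon R t))) =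
      ρ (x k) (F (monAct x π χ (trunc x π k y) (mon R t))) :=
    H.monAct_trunc_mem (W := LinearMap.eqLocus (F ∘ₗ monAct x π χ (x k)) (ρ (x k) ∘ₗ F)) (ih (x k))
      (fun i hki => hvar (Multiset.forall_mem_cons.2 ⟨hki.le, h⟩)) y
  have htrunc : F (monAct x π χ (trunc x π k y) (mon R (k ::ₘ t))) =
      ρ (trunc x π k y) (F (mon R (k ::ₘ t))) := by
    have ht : mon R t ∈ degLT R σ (t.card + 1) := mon_mem_degLT t.card.lt_succ_self
    have hcomm := LinearMap.congr_fun (H.lieDefect_monAct (trunc x π k y) (x k)) (mon R t)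
    rw [lieDefect_apply, LinearMap.zero_apply, sub_sub, sub_eq_zero, H.monAct_var h] at hcomm
    rw [hcomm, map_add, hk, ih _ _ ht, ih _ _ ht, ← H.monAct_var h, hvar h, LieHom.map_lie,
      LieRing.of_associative_ring_bracket, LinearMap.sub_apply, Module.End.mul_apply,
      Module.End.mul_apply, add_sub_cancel]
  have hreduce := map_trunc x π (j := k)
    (f := F ∘ₗ (monAct x π χ).flip (mon R (k ::ₘ t)) -
      LinearMap.applyₗ (F (mon R (k ::ₘ t))) ∘ₗ (ρ : L →ₗ[R] Module.End R V))
    (fun i hik => sub_eq_zero.2 (hvar (forall_mem_cons_le hik h))) y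
  exact sub_eq_zero.1 (hreduce.symm.trans (sub_eq_zero.2 htrunc))

variable (hv : ∀ p ∈ S, ρ p.1 v = p.2 • v)

include hv

theorem orderedMonomials_monAct_zero (y : L) :
    orderedMonomials x ρ v (monAct x π χ y (mon R 0)) = ρ y v := by
  have hdiff : orderedMonomials x ρ v ∘ₗ (monAct x π χ).flip (mon R 0) -
      LinearMap.applyₗ v ∘ₗ (ρ : L →ₗ[R] Module.End R V) = 0 :=
    H.hom_eq_zero
      (fun i => by
        change orderedMonomials x ρ v (monAct x π χ (x i) (mon R 0)) - ρ (x i) v = 0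
        rw [H.monAct_var (by simp), orderedMonomials_cons x ρ v (by simp), orderedMonomials_zero,
          sub_self])
      (fun p hp => by
        change orderedMonomials x ρ v (monAct x π χ p.1 (mon R 0)) - ρ p.1 v = 0
        rw [monAct_zero, H.coord_rel p hp, H.char_rel p hp, map_zero, LinearMap.zero_apply,
          zero_add, map_smul, orderedMonomials_zero, hv p hp, sub_self])
  exact sub_eq_zero.1 (LinearMap.congr_fun hdiff y)

theorem orderedMonomials_monAct (y : L) (w : Monomials R σ) :
    orderedMonomials x ρ v (monAct x π χ y w) = ρ y (orderedMonomials x ρ v w) := by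
  let W (y : L) : Submodule R (Monomials R σ) := LinearMap.eqLocus
    (orderedMonomials x ρ v ∘ₗ monAct x π χ y) (ρ y ∘ₗ orderedMonomials x ρ v)
  suffices hW : ∀ d y, degLT R σ d ≤ W y from
    (eq_top_of_degLT_le (hW · y)).ge (Submodule.mem_top (x := w))
  intro d
  induction d with
  | zero => exact fun y => degLT_le_iff.2 fun s hs => absurd hs s.card.not_lt_zero
  | succ d ih =>
    refine fun y => degLT_le_iff.2 fun s hs => ?_
    induction s using multiset_min_induction with
    | zero =>
      exact (H.orderedMonomials_monAct_zero hv y).trans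
        (congrArg _ (orderedMonomials_zero x ρ v).symm)
    | cons k t h =>
      have hdeg : degLT R σ (t.card + 1) ≤ degLT R σ d :=
        degLT_mono (by rw [Multiset.card_cons] at hs; omega)
      exact H.orderedMonomials_monAct_cons h (fun y w hw => ih y (hdeg hw)) y

end IsInduced

end Induced

section CyclicModule

attribute [local instance 100] LieRing.ofAssociativeRing

open UniversalEnvelopingAlgebra (ι)

variable {g : Type} [LieRing g] [LieAlgebra ℂ g] {M : Type} [AddCommGroup M] [Module ℂ M]
  [Module (UniversalEnvelopingAlgebra ℂ g) M]
  [IsScalarTower ℂ (UniversalEnvelopingAlgebra ℂ g) M]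

variable (g M) in
/-- The representation of `g` on a module over its enveloping algebra. -/
def actHom : g →ₗ⁅ℂ⁆ Module.End ℂ M :=
  (Algebra.lsmul ℂ ℂ M : UniversalEnvelopingAlgebra ℂ g →ₐ[ℂ] _).toLieHom.comp (ι ℂ)

theorem actHom_apply (y : g) : actHom g M y = act g M y := rfl

theorem exists_smul_gen_eq {S : Set (g × ℂ)} (w : CyclicModule S) :
    ∃ u : UniversalEnvelopingAlgebra ℂ g, u • CyclicModule.gen S = w := by
  obtain ⟨u, rfl⟩ := Submodule.Quotient.mk_surjective _ w
  exact ⟨u, by rw [CyclicModule.gen, ← Submodule.Quotient.mk_smul, smul_eq_mul, mul_one]⟩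

theorem act_gen {S : Set (g × ℂ)} {p : g × ℂ} (hp : p ∈ S) :
    act g (CyclicModule S) p.1 (CyclicModule.gen S) = p.2 • CyclicModule.gen S := by
  change ι ℂ p.1 • CyclicModule.gen S = _
  rw [← algebraMap_smul (UniversalEnvelopingAlgebra ℂ g) p.2 (CyclicModule.gen S), ← sub_eq_zero,
    ← sub_smul, CyclicModule.gen, ← Submodule.Quotient.mk_smul, Submodule.Quotient.mk_eq_zero,
    smul_eq_mul, mul_one]
  exact Submodule.subset_span ⟨p, hp, rfl⟩

namespace IsInduced

variable {σ : Type*} [LinearOrder σ] {x : σ → g} {π : g →ₗ[ℂ] σ →₀ ℂ} {χ : g →ₗ[ℂ] ℂ}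
  {S : Set (g × ℂ)} (H : IsInduced x π χ S)

theorem lift_rep_eq_zero {u : UniversalEnvelopingAlgebra ℂ g}
    (hu : u ∈ Submodule.span (UniversalEnvelopingAlgebra ℂ g)
      ((fun p : g × ℂ => ι ℂ p.1 - algebraMap ℂ (UniversalEnvelopingAlgebra ℂ g) p.2) '' S)) :
    UniversalEnvelopingAlgebra.lift ℂ H.rep u (mon ℂ 0) = 0 := by
  induction hu using Submodule.span_induction with
  | mem u hu =>
    obtain ⟨p, hp, rfl⟩ := hu
    rw [map_sub, AlgHom.commutes, UniversalEnvelopingAlgebra.lift_ι_apply, LinearMap.sub_apply,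
      rep_apply, monAct_zero, H.coord_rel p hp, H.char_rel p hp, Module.algebraMap_end_apply,
      map_zero, LinearMap.zero_apply, zero_add, sub_self]
  | zero => rw [map_zero, LinearMap.zero_apply]
  | add u w _ _ hu hw => rw [map_add, LinearMap.add_apply, hu, hw, add_zero]
  | smul a u _ hu => rw [smul_eq_mul, map_mul, Module.End.mul_apply, hu, map_zero]

/-- The map from the cyclic module to its model on monomials, sending the generator to `1`. -/
def toMonomials : CyclicModule S →ₗ[ℂ] Monomials ℂ σ :=
  ((Submodule.span (UniversalEnvelopingAlgebra ℂ g) _).restrictScalars ℂ).liftQ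
      ((UniversalEnvelopingAlgebra.lift ℂ H.rep).toLinearMap.flip (mon ℂ 0))
      (fun _ hu => H.lift_rep_eq_zero hu) ∘ₗ
    (Submodule.Quotient.restrictScalarsEquiv ℂ _).symm.toLinearMap

theorem toMonomials_smul_gen (u : UniversalEnvelopingAlgebra ℂ g) :
    H.toMonomials (u • CyclicModule.gen S) =
      UniversalEnvelopingAlgebra.lift ℂ H.rep u (mon ℂ 0) := by
  rw [CyclicModule.gen, ← Submodule.Quotient.mk_smul, smul_eq_mul, mul_one]
  rfl

variable (x S) in
theorem orderedMonomials_gen_mon (s : Multiset σ) :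
    orderedMonomials x (actHom g (CyclicModule S)) (CyclicModule.gen S) (mon ℂ s) =
      ((s.sort (· ≤ ·)).map fun i => ι ℂ (x i)).prod • CyclicModule.gen S := by
  have h := map_list_prod (Algebra.lsmul ℂ ℂ (CyclicModule S) :
    UniversalEnvelopingAlgebra ℂ g →ₐ[ℂ] _) ((s.sort (· ≤ ·)).map fun i => ι ℂ (x i))
  rw [List.map_map] at h
  rw [orderedMonomials_mon]
  exact (LinearMap.congr_fun h (CyclicModule.gen S)).symm

theorem orderedMonomials_lift_rep (u : UniversalEnvelopingAlgebra ℂ g) (w : Monomials ℂ σ) :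
    orderedMonomials x (actHom g (CyclicModule S)) (CyclicModule.gen S)
        (UniversalEnvelopingAlgebra.lift ℂ H.rep u w) =
      u • orderedMonomials x (actHom g (CyclicModule S)) (CyclicModule.gen S) w := by
  induction u using universalEnveloping_induction generalizing w with
  | halg a => rw [AlgHom.commutes, Module.algebraMap_end_apply, map_smul, algebraMap_smul]
  | hι y =>
    rw [UniversalEnvelopingAlgebra.lift_ι_apply, rep_apply,
      H.orderedMonomials_monAct fun p hp => act_gen hp]
    rfl
  | hadd u u' hu hu' => rw [map_add, LinearMap.add_apply, map_add, hu, hu', add_smul]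
  | hmul u u' hu hu' => rw [map_mul, Module.End.mul_apply, hu, hu', mul_smul]

theorem toMonomials_orderedMonomials (w : Monomials ℂ σ) :
    H.toMonomials (orderedMonomials x (actHom g (CyclicModule S)) (CyclicModule.gen S) w) = w := by
  have hlift (l : List σ) :
      UniversalEnvelopingAlgebra.lift ℂ H.rep (l.map fun i => ι ℂ (x i)).prod =
        (l.map fun i => H.rep (x i)).prod := by
    simp only [map_list_prod, List.map_map, Function.comp_def,
      UniversalEnvelopingAlgebra.lift_ι_apply]
  have hcomp :
      H.toMonomials ∘ₗ orderedMonomials x (actHom g (CyclicModule S)) (CyclicModule.gen S) =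
        LinearMap.id := by
    refine Finsupp.lhom_ext' fun s => LinearMap.ext_ring ?_
    change H.toMonomials (orderedMonomials _ _ _ (mon ℂ s)) = mon ℂ s
    rw [orderedMonomials_gen_mon, toMonomials_smul_gen, hlift, ← orderedMonomials_mon,
      orderedMonomials_rep, LinearMap.id_apply]
  exact LinearMap.congr_fun hcomp w

theorem orderedMonomials_toMonomials (w : CyclicModule S) :
    orderedMonomials x (actHom g (CyclicModule S)) (CyclicModule.gen S) (H.toMonomials w) = w := by
  obtain ⟨u, rfl⟩ := exists_smul_gen_eq w
  rw [toMonomials_smul_gen, orderedMonomials_lift_rep, orderedMonomials_zero]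

/-- The isomorphism of the cyclic module with its model on monomials. -/
def linearEquiv : CyclicModule S ≃ₗ[ℂ] Monomials ℂ σ :=
  { H.toMonomials with
    invFun := orderedMonomials x (actHom g (CyclicModule S)) (CyclicModule.gen S)
    left_inv := H.orderedMonomials_toMonomials
    right_inv := H.toMonomials_orderedMonomials }

/-- The Poincaré-Birkhoff-Witt basis of the cyclic module. -/
def basis : Module.Basis (Multiset σ) ℂ (CyclicModule S) :=
  Module.Basis.ofRepr H.linearEquiv

theorem basis_apply (s : Multiset σ) :
    H.basis s = ((s.sort (· ≤ ·)).map fun i => ι ℂ (x i)).prod • CyclicModule.gen S :=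
  orderedMonomials_gen_mon x S s

end IsInduced

end CyclicModule

/-- The factors of the monomial with given exponents: the terms with index `i + 1` of the three
sequences, and the last factor. -/
inductive Factor
  | first (i : ℕ)
  | second (i : ℕ)
  | third (i : ℕ)
  | last

namespace Factor

/-- The position of a factor in the ordered product. -/
def position : Factor → WithTop ℕ
  | first i => WithTop.some (3 * i)
  | second i => WithTop.some (3 * i + 1)
  | third i => WithTop.some (3 * i + 2)
  | last => ⊤

theorem position_injective : Function.Injective position := by
  rintro (i | i | i | _) (j | j | j | _) h <;>
    simp only [position, WithTop.coe_inj, WithTop.coe_ne_top, WithTop.top_ne_coe] at h <;>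
    first | rfl | omega | (congr 1; omega)

instance : LinearOrder Factor := LinearOrder.lift' position position_injective

theorem le_iff {a b : Factor} : a ≤ b ↔ a.position ≤ b.position := Iff.rfl

/-- The opposite of the index of the Virasoro generator standing for a factor: `L₋₃ᵢ₊₁`, `L₋₃ᵢ`,
`L₋₃ᵢ₋₁`, `i ≥ 1`, and `L₋₁`. -/
def degree : Factor → ℕ
  | first i => 3 * i + 2
  | second i => 3 * i + 3
  | third i => 3 * i + 4
  | last => 1

theorem degree_pos : ∀ a : Factor, 0 < a.degree
  | first _ | second _ | third _ | last => Nat.succ_pos _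

theorem degree_injective : Function.Injective degree := by
  rintro (i | i | i | _) (j | j | j | _) h <;> simp only [degree] at h <;>
    first | rfl | omega | (congr 1; omega)

theorem exists_degree_eq {d : ℕ} (hd : 0 < d) : ∃ a : Factor, a.degree = d := by
  obtain h | h | h | h : d = 1 ∨ d = 3 * ((d - 2) / 3) + 2 ∨ d = 3 * ((d - 2) / 3) + 3 ∨
    d = 3 * ((d - 2) / 3) + 4 := by omega
  exacts [⟨last, h.symm⟩, ⟨first _, h.symm⟩, ⟨second _, h.symm⟩, ⟨third _, h.symm⟩]

end Factor

namespace Exponents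

/-- The exponent of a factor. -/
def multiplicity (p : Exponents) : Factor → ℕ
  | .first i => p.k i
  | .second i => p.l i
  | .third i => p.m i
  | .last => p.n

/-- The factors with index `i + 1`, with multiplicities. -/
def block (p : Exponents) (i : ℕ) : List Factor :=
  List.replicate (p.k i) (.first i) ++ List.replicate (p.l i) (.second i) ++
    List.replicate (p.m i) (.third i)

/-- The factors of a monomial from left to right. -/
def toList (p : Exponents) : List Factor :=
  (List.range p.bound).flatMap p.block ++ List.replicate p.n .last

theorem mem_block {p : Exponents} {i : ℕ} {a : Factor} (h : a ∈ p.block i) :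
    a = .first i ∨ a = .second i ∨ a = .third i := by
  simp only [block, List.mem_append, List.mem_replicate] at h
  tauto

theorem pairwise_block (p : Exponents) (i : ℕ) : (p.block i).Pairwise (· ≤ ·) := by
  simp only [block, List.pairwise_append, List.pairwise_replicate, List.mem_append,
    List.mem_replicate, Factor.le_iff]
  refine ⟨⟨by simp, by simp, ?_⟩, by simp, ?_⟩
  · rintro a ⟨-, rfl⟩ b ⟨-, rfl⟩
    exact WithTop.coe_le_coe.2 (by omega)
  · rintro a (⟨-, rfl⟩ | ⟨-, rfl⟩) b ⟨-, rfl⟩ <;> exact WithTop.coe_le_coe.2 (by omega)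

theorem pairwise_toList (p : Exponents) : p.toList.Pairwise (· ≤ ·) := by
  rw [toList, List.pairwise_append, List.pairwise_flatMap]
  refine ⟨⟨fun i _ => p.pairwise_block i, ?_⟩, by simp, ?_⟩
  · refine List.pairwise_lt_range.imp fun {i j} hij a ha b hb => ?_
    rcases mem_block ha with rfl | rfl | rfl <;> rcases mem_block hb with rfl | rfl | rfl <;>
      exact WithTop.coe_le_coe.2 (by omega)
  · intro a _ b hb
    rw [List.eq_of_mem_replicate hb]
    exact le_top (a := a.position)

theorem prod_map_toList {A : Type} [Ring A] (f : Factor → A) (p : Exponents) :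
    (p.toList.map f).prod = orderedProduct (fun i => f (.first i)) (fun i => f (.second i))
      (fun i => f (.third i)) (f .last) p := by
  rw [toList, orderedProduct, List.map_append, List.prod_append, List.map_replicate,
    List.prod_replicate, List.map_flatMap, List.flatMap_def, List.prod_flatten, List.map_map]
  congr 3
  ext i
  simp only [Function.comp_apply, block, List.map_append, List.map_replicate, List.prod_append,
    List.prod_replicate]

theorem lt_bound {p : Exponents} {i : ℕ} (h : p.k i ≠ 0 ∨ p.l i ≠ 0 ∨ p.m i ≠ 0) :
    i < p.bound := by
  refine Nat.lt_of_succ_le (Finset.le_sup (f := Nat.succ) ?_)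
  simp only [Finset.mem_union, Finsupp.mem_support_iff]
  tauto

theorem sum_range_bound_ite (p : Exponents) {f : ℕ → ℕ} {i : ℕ} (hf : f i ≠ 0 → i < p.bound) :
    ((List.range p.bound).map fun j => if j = i then f j else 0).sum = f i := by
  change ∑ j ∈ Finset.range p.bound, (if j = i then f j else 0) = f i
  rw [Finset.sum_ite_eq', ite_eq_left_iff, Finset.mem_range]
  exact fun h => (not_imp_comm.1 hf h).symm

theorem count_toList (p : Exponents) (a : Factor) : p.toList.count a = p.multiplicity a := by
  rw [toList, List.count_append, List.count_flatMap]
  cases a with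
  | first i =>
    simpa [Function.comp_def, block, List.count_replicate, multiplicity] using
      p.sum_range_bound_ite (f := p.k) fun h => lt_bound (Or.inl h)
  | second i =>
    simpa [Function.comp_def, block, List.count_replicate, multiplicity] using
      p.sum_range_bound_ite (f := p.l) fun h => lt_bound (Or.inr (Or.inl h))
  | third i =>
    simpa [Function.comp_def, block, List.count_replicate, multiplicity] using
      p.sum_range_bound_ite (f := p.m) fun h => lt_bound (Or.inr (Or.inr h))
  | last => simp [Function.comp_def, block, List.count_replicate, multiplicity]

/-- The exponents of the monomial with given factors. -/
def ofMultiset (s : Multiset Factor) : Exponents where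
  k := (Multiset.toFinsupp s).comapDomain Factor.first fun _ _ _ _ => Factor.first.inj
  l := (Multiset.toFinsupp s).comapDomain Factor.second fun _ _ _ _ => Factor.second.inj
  m := (Multiset.toFinsupp s).comapDomain Factor.third fun _ _ _ _ => Factor.third.inj
  n := s.count .last

theorem multiplicity_ofMultiset (s : Multiset Factor) (a : Factor) :
    (ofMultiset s).multiplicity a = s.count a := by
  cases a <;> rfl

theorem multiplicity_injective : Function.Injective multiplicity := by
  rintro ⟨k, l, m, n⟩ ⟨k', l', m', n'⟩ h
  obtain rfl : k = k' := Finsupp.ext fun i => congrFun h (.first i)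
  obtain rfl : l = l' := Finsupp.ext fun i => congrFun h (.second i)
  obtain rfl : m = m' := Finsupp.ext fun i => congrFun h (.third i)
  obtain rfl : n = n' := congrFun h .last
  rfl

/-- The exponents of a monomial amount to the multiset of its factors. -/
def equivMultiset : Exponents ≃ Multiset Factor where
  toFun p := p.toList
  invFun := ofMultiset
  left_inv p := multiplicity_injective <| funext fun a => by
    rw [multiplicity_ofMultiset, Multiset.coe_count, count_toList]
  right_inv s := Multiset.ext' fun a => by
    rw [Multiset.coe_count, count_toList, multiplicity_ofMultiset]

theorem sort_equivMultiset (p : Exponents) : (equivMultiset p).sort (· ≤ ·) = p.toList := by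
  refine List.Perm.eq_of_pairwise (le := (· ≤ ·)) (fun a b _ _ => le_antisymm)
    (Multiset.pairwise_sort _ _) p.pairwise_toList ?_
  rw [← Multiset.coe_eq_coe, Multiset.sort_eq]
  rfl

/-- The sum of the values of a function on the factors of a monomial. -/
def weight (w : Factor → ℂ) (p : Exponents) : ℂ := ((equivMultiset p).map w).sum

/-- The `L₀`-weight of a monomial of the Virasoro algebra, relative to the generator. -/
def degree (p : Exponents) : ℕ := ((equivMultiset p).map Factor.degree).sum

theorem weight_degree (p : Exponents) : p.weight (fun a => a.degree) = p.degree := by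
  rw [weight, degree, Nat.cast_multiset_sum, Multiset.map_map]
  rfl

theorem finite_degree_eq (d : ℕ) : {p : Exponents | p.degree = d}.Finite := by
  let toPartition (p : {p : Exponents | p.degree = d}) : Nat.Partition d :=
    { parts := (equivMultiset p.1).map Factor.degree
      parts_pos := fun {i} hi => by
        obtain ⟨a, -, rfl⟩ := Multiset.mem_map.1 hi
        exact a.degree_pos
      parts_sum := p.2 }
  have hinj : Function.Injective toPartition := fun p q h =>
    Subtype.ext (equivMultiset.injective
      (Multiset.map_injective Factor.degree_injective (congrArg Nat.Partition.parts h)))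
  exact Finite.of_injective toPartition hinj

end Exponents

namespace IsInduced

variable {g : Type} [LieRing g] [LieAlgebra ℂ g] {x : Factor → g} {π : g →ₗ[ℂ] Factor →₀ ℂ}
  {χ : g →ₗ[ℂ] ℂ} {S : Set (g × ℂ)} (H : IsInduced x π χ S)

/-- The Poincaré-Birkhoff-Witt basis indexed by exponents. -/
def exponentBasis : Module.Basis Exponents ℂ (CyclicModule S) :=
  H.basis.reindex Exponents.equivMultiset.symm

theorem exponentBasis_apply (p : Exponents) :
    H.exponentBasis p =
      orderedProduct (fun i => UniversalEnvelopingAlgebra.ι ℂ (x (.first i)))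
        (fun i => UniversalEnvelopingAlgebra.ι ℂ (x (.second i)))
        (fun i => UniversalEnvelopingAlgebra.ι ℂ (x (.third i)))
        (UniversalEnvelopingAlgebra.ι ℂ (x .last)) p • CyclicModule.gen S := by
  rw [exponentBasis, Module.Basis.reindex_apply, Equiv.symm_symm, basis_apply,
    Exponents.sort_equivMultiset, Exponents.prod_map_toList]

end IsInduced

namespace Virasoro

/-- The coordinates of an element with respect to the `Lₛ` with `s < 0`, indexed by factors of
monomials. -/
def coord : Virasoro →ₗ[ℂ] Factor →₀ ℂ :=
  Finsupp.lcomapDomain (fun a => -(a.degree : ℤ))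
    (fun a b h => Factor.degree_injective (by simpa using h)) ∘ₗ fst

/-- The character of the span of `C` and the `Lₛ` with `s ≥ 0`, extended by zero. -/
def char (c h : ℂ) : Virasoro →ₗ[ℂ] ℂ :=
  c • (show Virasoro →ₗ[ℂ] ℂ from LinearMap.snd ℂ (ℤ →₀ ℂ) ℂ) + h • (Finsupp.lapply 0 ∘ₗ fst)

theorem coord_L_neg_degree (a : Factor) : coord (L (-a.degree)) = Finsupp.single a 1 := by
  ext b
  change Finsupp.single (-(a.degree : ℤ)) (1 : ℂ) (-(b.degree : ℤ)) = _
  simp only [Finsupp.single_apply, neg_inj, Nat.cast_inj, Factor.degree_injective.eq_iff]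

theorem coord_L_of_nonneg {s : ℤ} (hs : 0 ≤ s) : coord (L s) = 0 := by
  ext b
  have hb := b.degree_pos
  exact Finsupp.single_eq_of_ne (a' := -(b.degree : ℤ)) (by omega)

theorem coord_C : coord C = 0 := by
  rw [coord, LinearMap.comp_apply, fst_C, map_zero]

theorem char_L (c h : ℂ) (s : ℤ) : char c h (L s) = if s = 0 then h else 0 := by
  change c * 0 + h * Finsupp.single s (1 : ℂ) 0 = _
  rw [Finsupp.single_apply]
  split_ifs <;> simp

theorem char_C (c h : ℂ) : char c h C = c := by
  change c * 1 + h * (0 : ℤ →₀ ℂ) 0 = _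
  simp

theorem C_lie (x : Virasoro) : ⁅C, x⁆ = 0 := by
  rw [← lie_skew, lie_C, neg_zero]

theorem lie_L_zero_L (s : ℤ) : ⁅L 0, L s⁆ = (-s : ℂ) • L s := by
  simp [lie_L_L]

theorem linearCombination_L (f : ℤ →₀ ℂ) :
    Finsupp.linearCombination ℂ L f = ((f, 0) : (ℤ →₀ ℂ) × ℂ) := by
  have h : Finsupp.linearCombination ℂ L =
      (show (ℤ →₀ ℂ) →ₗ[ℂ] Virasoro from LinearMap.inl ℂ (ℤ →₀ ℂ) ℂ) :=
    Finsupp.lhom_ext' fun s => LinearMap.ext_ring (by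
      simp only [LinearMap.comp_apply, Finsupp.lsingle_apply, Finsupp.linearCombination_single,
        one_smul]
      rfl)
  exact LinearMap.congr_fun h f

theorem span_range_L_union_C : Submodule.span ℂ (Set.range L ∪ {C}) = ⊤ := by
  refine eq_top_iff.2 fun z _ => ?_
  have hz : z = Finsupp.linearCombination ℂ L z.1 + z.2 • C := by
    have h : z = (((z.1, 0) : (ℤ →₀ ℂ) × ℂ) + z.2 • ((0, 1) : (ℤ →₀ ℂ) × ℂ) : (ℤ →₀ ℂ) × ℂ) :=
      Prod.ext (by simp) (by simp)
    exact h.trans (congrArg (· + z.2 • C) (linearCombination_L z.1).symm)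
  rw [hz, Submodule.span_union, Submodule.mem_sup]
  exact ⟨_, Finsupp.mem_span_range_iff_exists_finsupp.2 ⟨z.1, rfl⟩, _,
    Submodule.smul_mem _ z.2 (Submodule.subset_span rfl), rfl⟩

theorem mem_relations_cases {c h : ℂ} {p : Virasoro × ℂ} (hp : p ∈ virasoroRelations c h) :
    p = (C, c) ∨ ∃ n : ℕ, p = (L n, if n = 0 then h else 0) := by
  rcases hp with (rfl | rfl) | ⟨n, rfl⟩
  · exact Or.inl rfl
  · exact Or.inr ⟨0, by simp⟩
  · exact Or.inr ⟨n + 1, by simp⟩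

theorem lie_relations {W : Type*} [AddCommGroup W] [Module ℂ W] {f : Virasoro →ₗ[ℂ] W}
    (hf : ∀ s : ℤ, 0 < s → f (L s) = 0) {c h : ℂ} {p q : Virasoro × ℂ}
    (hp : p ∈ virasoroRelations c h) (hq : q ∈ virasoroRelations c h) : f ⁅p.1, q.1⁆ = 0 := by
  rcases mem_relations_cases hp with rfl | ⟨m, rfl⟩
  · rw [C_lie, map_zero]
  rcases mem_relations_cases hq with rfl | ⟨n, rfl⟩
  · rw [lie_C, map_zero]
  rw [lie_L_L, map_add, map_smul]
  by_cases hmn : (m : ℤ) + n = 0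
  · obtain rfl : m = 0 := by omega
    obtain rfl : n = 0 := by omega
    simp
  · simp [hmn, hf (m + n) (by omega)]

theorem span_variables_union_relations (c h : ℂ) :
    Submodule.span ℂ ((Set.range fun a : Factor => L (-a.degree)) ∪
      Prod.fst '' virasoroRelations c h) = ⊤ := by
  rw [eq_top_iff, ← span_range_L_union_C, Submodule.span_le]
  rintro _ (⟨s, rfl⟩ | rfl) <;> refine Submodule.subset_span ?_
  · rcases lt_trichotomy s 0 with hs | rfl | hs
    · obtain ⟨a, ha⟩ := Factor.exists_degree_eq (show 0 < (-s).toNat by omega)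
      exact Or.inl ⟨a, congrArg L (by omega)⟩
    · exact Or.inr ⟨_, Or.inl (Or.inr rfl), rfl⟩
    · exact Or.inr ⟨_, Or.inr ⟨(s - 1).toNat, rfl⟩, congrArg L (by omega)⟩
  · exact Or.inr ⟨_, Or.inl (Or.inl rfl), rfl⟩

theorem isInduced (c h : ℂ) :
    IsInduced (fun a : Factor => L (-a.degree)) coord (char c h) (virasoroRelations c h) where
  coord_var := coord_L_neg_degree
  coord_rel p hp := by
    rcases mem_relations_cases hp with rfl | ⟨n, rfl⟩
    exacts [coord_C, coord_L_of_nonneg (by omega)]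
  char_rel p hp := by
    rcases mem_relations_cases hp with rfl | ⟨n, rfl⟩
    · exact char_C c h
    · simp [char_L]
  char_var a := by rw [char_L, if_neg (by have := a.degree_pos; omega)]
  coord_lie p hp q hq := lie_relations (fun s hs => coord_L_of_nonneg hs.le) hp hq
  char_lie p hp q hq :=
    lie_relations (fun s hs => by rw [char_L, if_neg hs.ne']) hp hq
  span_eq_top := span_variables_union_relations c h

/-- The basis of the Verma module consisting of the monomials in the `Lₛ`. -/
def basis (c h : ℂ) : Module.Basis Exponents ℂ (VirasoroVerma c h) := (isInduced c h).exponentBasis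

theorem basis_apply (c h : ℂ) (p : Exponents) : basis c h p = virasoroMonomial c h p := by
  have hfirst (i : ℕ) : -((Factor.first i).degree : ℤ) = -3 * (i + 1) + 1 := by
    rw [Factor.degree]; omega
  have hsecond (i : ℕ) : -((Factor.second i).degree : ℤ) = -3 * (i + 1) := by
    rw [Factor.degree]; omega
  have hthird (i : ℕ) : -((Factor.third i).degree : ℤ) = -3 * (i + 1) - 1 := by
    rw [Factor.degree]; omega
  refine ((isInduced c h).exponentBasis_apply p).trans ?_
  simp only [hfirst, hsecond, hthird]
  rfl

end Virasoro

/-- The matrix entry at `(i, j)` as a linear function on `sl₂`. -/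
def sl2Entry (i j : Fin 2) : Sl2 →ₗ[ℂ] ℂ where
  toFun x := x.1 i j
  map_add' _ _ := rfl
  map_smul' _ _ := rfl

theorem sl2Entry_apply (i j : Fin 2) (x : Sl2) : sl2Entry i j x = x.1 i j := rfl

theorem sl2Entry_lie (i j : Fin 2) (x y : Sl2) :
    sl2Entry i j ⁅x, y⁆ = sl2Entry i 0 x * sl2Entry 0 j y + sl2Entry i 1 x * sl2Entry 1 j y -
      (sl2Entry i 0 y * sl2Entry 0 j x + sl2Entry i 1 y * sl2Entry 1 j x) := by
  simp only [sl2Entry_apply, LieAlgebra.SpecialLinear.sl_bracket, Matrix.sub_apply,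
    Matrix.mul_apply, Fin.sum_univ_two]

theorem sl2_ext {x y : Sl2} (h : ∀ i j, x.1 i j = y.1 i j) : x = y :=
  Subtype.ext (Matrix.ext h)

theorem sl2_eq_sum (x : Sl2) :
    x = sl2Entry 0 1 x • sl2E + sl2Entry 0 0 x • sl2H + sl2Entry 1 0 x • sl2F := by
  have htrace : x.1 0 0 + x.1 1 1 = 0 := by
    rw [← Matrix.trace_fin_two]
    exact LinearMap.mem_ker.1 x.2
  refine sl2_ext fun i j => ?_
  change x.1 i j = x.1 0 1 * sl2E.1 i j + x.1 0 0 * sl2H.1 i j + x.1 1 0 * sl2F.1 i j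
  fin_cases i <;> fin_cases j <;> simp [sl2E, sl2H, sl2F]
  linear_combination htrace

theorem sl2_lie_H_E : ⁅sl2H, sl2E⁆ = (2 : ℂ) • sl2E := by
  refine sl2_ext fun i j => ?_
  rw [LieAlgebra.SpecialLinear.sl_bracket]
  fin_cases i <;> fin_cases j <;> (simp [sl2E, sl2H]; try norm_num)

theorem sl2_lie_H_F : ⁅sl2H, sl2F⁆ = (-2 : ℂ) • sl2F := by
  refine sl2_ext fun i j => ?_
  rw [LieAlgebra.SpecialLinear.sl_bracket]
  fin_cases i <;> fin_cases j <;> (simp [sl2F, sl2H]; try norm_num)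

theorem sl2_lie_E_F : ⁅sl2E, sl2F⁆ = sl2H := by
  refine sl2_ext fun i j => ?_
  rw [LieAlgebra.SpecialLinear.sl_bracket]
  fin_cases i <;> fin_cases j <;> simp [sl2E, sl2F, sl2H]

theorem sl2_trace_E_F : Matrix.trace (sl2E.1 * sl2F.1) = 1 := by
  simp [sl2E, sl2F, Matrix.trace_fin_two]

theorem sl2_trace_H_H : Matrix.trace (sl2H.1 * sl2H.1) = 2 := by
  simp [sl2H, Matrix.trace_fin_two]
  norm_num

theorem sl2_trace_H_E : Matrix.trace (sl2H.1 * sl2E.1) = 0 := by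
  simp [sl2H, sl2E, Matrix.trace_fin_two]

theorem sl2_trace_H_F : Matrix.trace (sl2H.1 * sl2F.1) = 0 := by
  simp [sl2H, sl2F, Matrix.trace_fin_two]

theorem mode_add (x y : Sl2) (n : ℤ) : mode (x + y) n = mode x n + mode y n := by
  rw [mode, mode, mode, ← LieAlgebra.of_add, Prod.mk_add_mk, TensorProduct.tmul_add, add_zero]

theorem mode_smul (a : ℂ) (x : Sl2) (n : ℤ) : mode (a • x) n = a • mode x n := by
  rw [mode, mode, ← LieAlgebra.of_smul, Prod.smul_mk, TensorProduct.tmul_smul, smul_zero]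

theorem centralK_lie (x : AffineSl2) : ⁅centralK, x⁆ = 0 := by
  rw [← lie_skew, lie_centralK, neg_zero]

/-- The component of an element of the affine Lie algebra in the loop algebra, as a Laurent
polynomial with coefficients in `sl₂`. -/
def affineLoop : AffineSl2 →ₗ[ℂ] ℤ →₀ Sl2 :=
  (LieAlgebra.LoopAlgebra.toFinsupp ℂ ℤ Sl2).toLinearMap ∘ₗ
    { toFun := fun y => ((LieAlgebra.ofProd affineCocycle).symm y).1
      map_add' := fun _ _ => rfl
      map_smul' := fun _ _ => rfl }

/-- The coefficient of the central element `K`. -/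
def affineCenter : AffineSl2 →ₗ[ℂ] ℂ :=
  (TrivialLieModule.equiv ℂ LoopSl2 ℂ).toLinearMap ∘ₗ
    { toFun := fun y => ((LieAlgebra.ofProd affineCocycle).symm y).2
      map_add' := fun _ _ => rfl
      map_smul' := fun _ _ => rfl }

theorem affineLoop_mode (x : Sl2) (n : ℤ) : affineLoop (mode x n) = Finsupp.single n x :=
  LieAlgebra.LoopAlgebra.toFinsupp_single_tmul ℂ ℤ Sl2 n x

theorem affineLoop_centralK : affineLoop centralK = 0 :=
  map_zero (LieAlgebra.LoopAlgebra.toFinsupp ℂ ℤ Sl2)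

theorem affineCenter_mode (x : Sl2) (n : ℤ) : affineCenter (mode x n) = 0 :=
  map_zero (TrivialLieModule.equiv ℂ LoopSl2 ℂ)

theorem affineCenter_centralK : affineCenter centralK = 1 :=
  (TrivialLieModule.equiv ℂ LoopSl2 ℂ).apply_symm_apply 1

/-- The number `n` of the mode `x₋ₙ` occurring in a factor of an affine monomial. -/
def Factor.modeNumber : Factor → ℕ
  | first i => i + 1
  | second i => i + 1
  | third i => i + 1
  | last => 0

/-- The two Borel subalgebras of `sl₂` containing `h`. The choice of one of them distinguishes
highest-weight from lowest-weight Verma modules. -/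
inductive Borel
  | highest
  | lowest

namespace Borel

/-- The sign of the root of `b` relative to that of `e`. -/
def sign : Borel → ℂ
  | highest => 1
  | lowest => -1

/-- The root vector in the Borel subalgebra. -/
def raising : Borel → Sl2
  | highest => sl2E
  | lowest => sl2F

/-- The root vector outside the Borel subalgebra. -/
def lowering : Borel → Sl2
  | highest => sl2F
  | lowest => sl2E

/-- The coefficient of `b.raising`. -/
def raisingCoord : Borel → Sl2 →ₗ[ℂ] ℂ
  | highest => sl2Entry 0 1
  | lowest => sl2Entry 1 0

/-- The coefficient of `b.lowering`, which vanishes exactly on the Borel subalgebra. -/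
def loweringCoord : Borel → Sl2 →ₗ[ℂ] ℂ
  | highest => sl2Entry 1 0
  | lowest => sl2Entry 0 1

/-- The defining relations of the Verma module induced from `b`. -/
def relations : Borel → ℂ → ℂ → Set (AffineSl2 × ℂ)
  | highest => highestRelations
  | lowest => lowestRelations

/-- The element `x` of `sl₂` in a factor `x₋ₙ` of a monomial. -/
def rootVector (b : Borel) : Factor → Sl2
  | .first _ => b.raising
  | .second _ => sl2H
  | .third _ => b.lowering
  | .last => b.lowering

/-- The elements of the affine Lie algebra whose ordered products give the
Poincaré-Birkhoff-Witt basis. -/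
def factor (b : Borel) (a : Factor) : AffineSl2 := mode (b.rootVector a) (-a.modeNumber)

/-- The `h₀`-weight of a factor of a monomial. -/
def cartanWeight (b : Borel) : Factor → ℂ
  | .first _ => 2 * b.sign
  | .second _ => 0
  | .third _ => -(2 * b.sign)
  | .last => -(2 * b.sign)

section Sl2

variable (b : Borel)

theorem eq_sum (x : Sl2) :
    x = b.raisingCoord x • b.raising + sl2Entry 0 0 x • sl2H + b.loweringCoord x • b.lowering := by
  cases b with
  | highest => exact sl2_eq_sum x
  | lowest =>
    refine (sl2_eq_sum x).trans ?_
    simp only [raisingCoord, loweringCoord, raising, lowering]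
    abel

@[simp] theorem raisingCoord_raising : b.raisingCoord b.raising = 1 := by
  cases b <;> simp [raisingCoord, raising, sl2Entry_apply, sl2E, sl2F]

@[simp] theorem raisingCoord_H : b.raisingCoord sl2H = 0 := by
  cases b <;> simp [raisingCoord, sl2Entry_apply, sl2H]

@[simp] theorem raisingCoord_lowering : b.raisingCoord b.lowering = 0 := by
  cases b <;> simp [raisingCoord, lowering, sl2Entry_apply, sl2E, sl2F]

@[simp] theorem entry_raising : sl2Entry 0 0 b.raising = 0 := by
  cases b <;> simp [raising, sl2Entry_apply, sl2E, sl2F]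

@[simp] theorem entry_H : sl2Entry 0 0 sl2H = 1 := by
  simp [sl2Entry_apply, sl2H]

@[simp] theorem entry_lowering : sl2Entry 0 0 b.lowering = 0 := by
  cases b <;> simp [lowering, sl2Entry_apply, sl2E, sl2F]

@[simp] theorem loweringCoord_raising : b.loweringCoord b.raising = 0 := by
  cases b <;> simp [loweringCoord, raising, sl2Entry_apply, sl2E, sl2F]

@[simp] theorem loweringCoord_H : b.loweringCoord sl2H = 0 := by
  cases b <;> simp [loweringCoord, sl2Entry_apply, sl2H]

@[simp] theorem loweringCoord_lowering : b.loweringCoord b.lowering = 1 := by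
  cases b <;> simp [loweringCoord, lowering, sl2Entry_apply, sl2E, sl2F]

theorem lie_raising_lowering : ⁅b.raising, b.lowering⁆ = b.sign • sl2H := by
  cases b with
  | highest => rw [raising, lowering, sl2_lie_E_F, sign, one_smul]
  | lowest => rw [raising, lowering, ← lie_skew, sl2_lie_E_F, sign, neg_one_smul]

theorem lie_H_rootVector (a : Factor) :
    ⁅sl2H, b.rootVector a⁆ = b.cartanWeight a • b.rootVector a := by
  have hE := sl2_lie_H_E
  have hF := sl2_lie_H_F
  cases b <;> cases a <;>
    simp [rootVector, raising, lowering, cartanWeight, sign, hE, hF]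

variable {b}

theorem loweringCoord_lie {x y : Sl2} (hx : b.loweringCoord x = 0) (hy : b.loweringCoord y = 0) :
    b.loweringCoord ⁅x, y⁆ = 0 := by
  cases b
  all_goals
    simp only [loweringCoord] at hx hy ⊢
    rw [sl2Entry_lie, hx, hy]
    ring

theorem entry_lie {x y : Sl2} (hx : b.loweringCoord x = 0) (hy : b.loweringCoord y = 0) :
    sl2Entry 0 0 ⁅x, y⁆ = 0 := by
  cases b
  all_goals
    simp only [loweringCoord] at hx hy ⊢
    rw [sl2Entry_lie, hx, hy]
    ring

end Sl2

theorem factor_first (b : Borel) (i : ℕ) : b.factor (.first i) = mode b.raising (-(i + 1)) := rfl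

theorem factor_second (b : Borel) (i : ℕ) : b.factor (.second i) = mode sl2H (-(i + 1)) := rfl

theorem factor_third (b : Borel) (i : ℕ) : b.factor (.third i) = mode b.lowering (-(i + 1)) := rfl

theorem factor_last (b : Borel) : b.factor .last = mode b.lowering 0 := rfl

section Relations

variable {b : Borel} {k ν : ℂ}

theorem centralK_mem_relations : (centralK, k) ∈ b.relations k ν := by
  cases b <;> exact Or.inl (Or.inl rfl)

theorem cartan_mem_relations : (mode sl2H 0, ν) ∈ b.relations k ν := by
  cases b <;> exact Or.inl (Or.inr (Or.inl rfl))

theorem raising_mem_relations : (mode b.raising 0, 0) ∈ b.relations k ν := by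
  cases b <;> exact Or.inl (Or.inr (Or.inr rfl))

theorem positive_mem_relations (x : Sl2) (n : ℕ) : (mode x (n + 1), 0) ∈ b.relations k ν := by
  cases b <;> exact Or.inr ⟨x, n, rfl⟩

instance : IsSmooth (CyclicModule (b.relations k ν)) :=
  isSmooth_cyclicModule _ positive_mem_relations

theorem mem_relations_cases {p : AffineSl2 × ℂ} (hp : p ∈ b.relations k ν) :
    p = (centralK, k) ∨ ∃ (x : Sl2) (n : ℕ), (n = 0 → b.loweringCoord x = 0) ∧
      p = (mode x n, if n = 0 then ν * sl2Entry 0 0 x else 0) := by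
  have hp' : p = (centralK, k) ∨ p = (mode sl2H 0, ν) ∨ p = (mode b.raising 0, 0) ∨
      ∃ (x : Sl2) (n : ℕ), p = (mode x (n + 1), 0) := by
    cases b <;> simpa [relations, raising, highestRelations, lowestRelations, or_assoc] using hp
  rcases hp' with rfl | rfl | rfl | ⟨x, n, rfl⟩
  · exact Or.inl rfl
  · exact Or.inr ⟨sl2H, 0, by simp, by simp⟩
  · exact Or.inr ⟨b.raising, 0, by simp, by simp⟩
  · exact Or.inr ⟨x, n + 1, by simp, by simp⟩

theorem lie_mode_mode_natCast (x y : Sl2) (m n : ℕ) :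
    ⁅mode x m, mode y n⁆ = mode ⁅x, y⁆ (m + n) := by
  rw [lie_mode_mode]
  split_ifs with h
  · obtain rfl : m = 0 := by omega
    simp
  · simp

theorem lie_relations {W : Type*} [AddCommGroup W] [Module ℂ W] {f : AffineSl2 →ₗ[ℂ] W}
    (hzero : ∀ x y, b.loweringCoord x = 0 → b.loweringCoord y = 0 → f (mode ⁅x, y⁆ 0) = 0)
    (hpos : ∀ (x : Sl2) (n : ℤ), 0 < n → f (mode x n) = 0) {p q : AffineSl2 × ℂ}
    (hp : p ∈ b.relations k ν) (hq : q ∈ b.relations k ν) : f ⁅p.1, q.1⁆ = 0 := by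
  rcases mem_relations_cases hp with rfl | ⟨x, m, hx, rfl⟩
  · rw [centralK_lie, map_zero]
  rcases mem_relations_cases hq with rfl | ⟨y, n, hy, rfl⟩
  · rw [lie_centralK, map_zero]
  rw [lie_mode_mode_natCast]
  rcases eq_or_ne (m + n) 0 with hmn | hmn
  · obtain ⟨rfl, rfl⟩ := Nat.add_eq_zero_iff.1 hmn
    exact hzero x y (hx rfl) (hy rfl)
  · exact hpos _ _ (by omega)

end Relations

section Induced

variable (b : Borel) (k ν : ℂ)

/-- The coordinates of the mode `xₙ` with respect to the factors of monomials. -/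
def modeCoord : ℤ → Sl2 →ₗ[ℂ] Factor →₀ ℂ
  | .negSucc i => Finsupp.lsingle (.first i) ∘ₗ b.raisingCoord +
      Finsupp.lsingle (.second i) ∘ₗ sl2Entry 0 0 + Finsupp.lsingle (.third i) ∘ₗ b.loweringCoord
  | .ofNat 0 => Finsupp.lsingle .last ∘ₗ b.loweringCoord
  | .ofNat (_ + 1) => 0

/-- The coordinates of an element of the affine Lie algebra with respect to the factors of
monomials. -/
def coord : AffineSl2 →ₗ[ℂ] Factor →₀ ℂ := Finsupp.lsum ℂ b.modeCoord ∘ₗ affineLoop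

/-- The character of the subalgebra from which the Verma module is induced, extended by zero. -/
def char : AffineSl2 →ₗ[ℂ] ℂ :=
  k • affineCenter + ν • (sl2Entry 0 0 ∘ₗ Finsupp.lapply 0 ∘ₗ affineLoop)

theorem coord_mode (x : Sl2) (n : ℤ) : b.coord (mode x n) = b.modeCoord n x := by
  rw [coord, LinearMap.comp_apply, affineLoop_mode, Finsupp.lsum_single]

theorem coord_mode_neg (x : Sl2) (i : ℕ) : b.coord (mode x (-(i + 1))) =
    Finsupp.single (.first i) (b.raisingCoord x) + Finsupp.single (.second i) (sl2Entry 0 0 x) +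
      Finsupp.single (.third i) (b.loweringCoord x) := by
  rw [← Int.negSucc_eq, coord_mode]
  rfl

theorem coord_mode_zero (x : Sl2) :
    b.coord (mode x 0) = Finsupp.single .last (b.loweringCoord x) :=
  b.coord_mode x 0

theorem coord_mode_of_pos (x : Sl2) {n : ℤ} (hn : 0 < n) : b.coord (mode x n) = 0 := by
  obtain ⟨m, rfl⟩ : ∃ m : ℕ, n = Int.ofNat (m + 1) := ⟨n.toNat - 1, by simp; omega⟩
  exact b.coord_mode x _

theorem coord_centralK : b.coord centralK = 0 := by
  rw [coord, LinearMap.comp_apply, affineLoop_centralK, map_zero]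

theorem coord_factor (a : Factor) : b.coord (b.factor a) = Finsupp.single a 1 := by
  cases a <;> simp only [factor_first, factor_second, factor_third, factor_last, coord_mode_neg,
    coord_mode_zero] <;> simp

theorem char_mode (x : Sl2) (n : ℤ) :
    char k ν (mode x n) = if n = 0 then ν * sl2Entry 0 0 x else 0 := by
  simp only [char, LinearMap.add_apply, LinearMap.smul_apply, LinearMap.comp_apply,
    affineCenter_mode, affineLoop_mode, Finsupp.lapply_apply, Finsupp.single_apply]
  split_ifs <;> simp

theorem char_centralK : char k ν centralK = k := by
  simp [char, affineCenter_centralK, affineLoop_centralK]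

theorem char_factor (a : Factor) : char k ν (b.factor a) = 0 := by
  rw [factor, char_mode, ite_eq_right_iff]
  cases a <;> simp [Factor.modeNumber, rootVector]
  all_goals omega

theorem mode_mem_span_factor_union_relations (x : Sl2) (n : ℤ) :
    mode x n ∈ Submodule.span ℂ (Set.range b.factor ∪ Prod.fst '' b.relations k ν) := by
  have hfactor (a : Factor) : b.factor a ∈
      Submodule.span ℂ (Set.range b.factor ∪ Prod.fst '' b.relations k ν) :=
    Submodule.subset_span (Or.inl ⟨a, rfl⟩)
  have hrel {p : AffineSl2 × ℂ} (hp : p ∈ b.relations k ν) : p.1 ∈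
      Submodule.span ℂ (Set.range b.factor ∪ Prod.fst '' b.relations k ν) :=
    Submodule.subset_span (Or.inr ⟨p, hp, rfl⟩)
  have hsum (n : ℤ) : mode x n = b.raisingCoord x • mode b.raising n +
      sl2Entry 0 0 x • mode sl2H n + b.loweringCoord x • mode b.lowering n := by
    nth_rw 1 [b.eq_sum x]
    simp only [mode_add, mode_smul]
  rcases lt_trichotomy n 0 with hn | rfl | hn
  · obtain ⟨i, rfl⟩ : ∃ i : ℕ, n = -(i + 1) := ⟨(-n - 1).toNat, by omega⟩
    rw [hsum, ← factor_first, ← factor_second, ← factor_third]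
    exact add_mem (add_mem (Submodule.smul_mem _ _ (hfactor _))
      (Submodule.smul_mem _ _ (hfactor _))) (Submodule.smul_mem _ _ (hfactor _))
  · rw [hsum, ← factor_last]
    exact add_mem (add_mem (Submodule.smul_mem _ _ (hrel raising_mem_relations))
      (Submodule.smul_mem _ _ (hrel cartan_mem_relations))) (Submodule.smul_mem _ _ (hfactor _))
  · obtain ⟨i, rfl⟩ : ∃ i : ℕ, n = i + 1 := ⟨(n - 1).toNat, by omega⟩
    exact hrel (positive_mem_relations x i)

theorem span_factor_union_relations :
    Submodule.span ℂ (Set.range b.factor ∪ Prod.fst '' b.relations k ν) = ⊤ := by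
  refine eq_top_iff.2 fun y _ => ?_
  induction y using affine_induction with
  | hmode x n => exact b.mode_mem_span_factor_union_relations k ν x n
  | hK => exact Submodule.subset_span (Or.inr ⟨_, centralK_mem_relations, rfl⟩)
  | hadd y z hy hz => exact add_mem (hy trivial) (hz trivial)
  | hsmul a y hy => exact Submodule.smul_mem _ a (hy trivial)

theorem isInduced : IsInduced b.factor b.coord (char k ν) (b.relations k ν) where
  coord_var := b.coord_factor
  coord_rel p hp := by
    rcases mem_relations_cases hp with rfl | ⟨x, n, hx, rfl⟩
    · exact b.coord_centralK
    rcases n.eq_zero_or_pos with rfl | hn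
    · exact (b.coord_mode_zero x).trans (by rw [hx rfl, Finsupp.single_zero])
    · exact b.coord_mode_of_pos x (by omega)
  char_rel p hp := by
    rcases mem_relations_cases hp with rfl | ⟨x, n, -, rfl⟩
    · exact char_centralK k ν
    · simp [char_mode]
  char_var := b.char_factor k ν
  coord_lie p hp q hq := lie_relations
    (fun x y hx hy => by rw [coord_mode_zero, loweringCoord_lie hx hy, Finsupp.single_zero])
    (fun x n => b.coord_mode_of_pos x) hp hq
  char_lie p hp q hq := lie_relations
    (fun x y hx hy => by rw [char_mode, if_pos rfl, entry_lie hx hy, mul_zero])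
    (fun x n hn => by rw [char_mode, if_neg hn.ne']) hp hq
  span_eq_top := b.span_factor_union_relations k ν

/-- The basis of monomials of the Verma module induced from `b`. -/
def basis : Module.Basis Exponents ℂ (CyclicModule (b.relations k ν)) :=
  (b.isInduced k ν).exponentBasis

theorem basis_highest (p : Exponents) : highest.basis k ν p = affineMonomial k ν p :=
  (highest.isInduced k ν).exponentBasis_apply p

theorem basis_lowest (p : Exponents) : lowest.basis k ν p = affineMonomialLowest k ν p :=
  (lowest.isInduced k ν).exponentBasis_apply p

end Induced

end Borel

section Commutators

attribute [local instance 100] LieRing.ofAssociativeRing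

theorem lie_mul_eq {A : Type*} [Ring A] (a b c : A) : ⁅a, b * c⁆ = ⁅a, b⁆ * c + b * ⁅a, c⁆ := by
  simp only [Ring.lie_def]
  noncomm_ring

theorem lie_lie_eq_smul {R L : Type*} [CommRing R] [LieRing L] [LieAlgebra R L] {d x y : L}
    {a b : R} (hx : ⁅d, x⁆ = a • x) (hy : ⁅d, y⁆ = b • y) : ⁅d, ⁅x, y⁆⁆ = (a + b) • ⁅x, y⁆ := by
  rw [leibniz_lie, hx, hy, smul_lie, lie_smul, add_smul]

theorem apply_prod_map_eq_smul {R V σ : Type*} [CommRing R] [AddCommGroup V] [Module R V]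
    {d : Module.End R V} {x : σ → Module.End R V} {α : σ → R} (hx : ∀ i, ⁅d, x i⁆ = α i • x i)
    {v : V} {c : R} (hv : d v = c • v) (l : List σ) :
    d ((l.map x).prod v) = ((l.map α).sum + c) • (l.map x).prod v := by
  induction l with
  | nil => simpa using hv
  | cons i l ih =>
    have hcomm (w : V) : d (x i w) = ⁅d, x i⁆ w + x i (d w) := by
      rw [Ring.lie_def, LinearMap.sub_apply, Module.End.mul_apply, Module.End.mul_apply,
        sub_add_cancel]
    rw [List.map_cons, List.prod_cons, Module.End.mul_apply, hcomm, hx, ih, map_smul,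
      LinearMap.smul_apply, ← add_smul, List.map_cons, List.sum_cons, add_assoc]

theorem act_lie {g M : Type} [LieRing g] [LieAlgebra ℂ g] [AddCommGroup M] [Module ℂ M]
    [Module (UniversalEnvelopingAlgebra ℂ g) M] [IsScalarTower ℂ (UniversalEnvelopingAlgebra ℂ g) M]
    (y z : g) : act g M ⁅y, z⁆ = ⁅act g M y, act g M z⁆ :=
  (actHom g M).map_lie y z

namespace IsInduced

variable {g : Type} [LieRing g] [LieAlgebra ℂ g] {x : Factor → g} {π : g →ₗ[ℂ] Factor →₀ ℂ}
  {χ : g →ₗ[ℂ] ℂ} {S : Set (g × ℂ)} (H : IsInduced x π χ S)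

theorem apply_exponentBasis {d : Module.End ℂ (CyclicModule S)} {α : Factor → ℂ}
    (hd : ∀ a, ⁅d, act g (CyclicModule S) (x a)⁆ = α a • act g (CyclicModule S) (x a)) {c : ℂ}
    (hgen : d (CyclicModule.gen S) = c • CyclicModule.gen S) (p : Exponents) :
    d (H.exponentBasis p) = (p.weight α + c) • H.exponentBasis p := by
  have hbasis : H.exponentBasis p =
      (p.toList.map fun a => act g (CyclicModule S) (x a)).prod (CyclicModule.gen S) := by
    have hprod := map_list_prod (Algebra.lsmul ℂ ℂ (CyclicModule S) :
      UniversalEnvelopingAlgebra ℂ g →ₐ[ℂ] _)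
        (p.toList.map fun a => UniversalEnvelopingAlgebra.ι ℂ (x a))
    rw [List.map_map] at hprod
    rw [exponentBasis, Module.Basis.reindex_apply, Equiv.symm_symm, basis_apply,
      Exponents.sort_equivMultiset]
    exact LinearMap.congr_fun hprod (CyclicModule.gen S)
  rw [hbasis]
  exact apply_prod_map_eq_smul hd hgen p.toList

include H in
theorem act_eq_smul_one_of_central {z : g} {c : ℂ} (hz : ∀ y : g, ⁅z, y⁆ = 0) (hS : (z, c) ∈ S) :
    act g (CyclicModule S) z = c • 1 := by
  refine H.exponentBasis.ext fun p => ?_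
  have hd (a : Factor) : ⁅act g (CyclicModule S) z, act g (CyclicModule S) (x a)⁆ =
      (0 : ℂ) • act g (CyclicModule S) (x a) := by
    rw [← act_lie, hz, zero_smul]
    exact (actHom g (CyclicModule S)).map_zero
  rw [H.apply_exponentBasis hd (act_gen hS)]
  simp [Exponents.weight]

end IsInduced

theorem Virasoro.act_L_zero_basis (c h : ℂ) (p : Exponents) :
    act Virasoro (VirasoroVerma c h) (L 0) (basis c h p) = (p.degree + h) • basis c h p := by
  rw [← p.weight_degree]
  refine (isInduced c h).apply_exponentBasis (fun a => ?_) (act_gen (Or.inl (Or.inr rfl))) p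
  rw [← act_lie, lie_L_zero_L, Int.cast_neg, neg_neg, Int.cast_natCast]
  exact (actHom _ _).map_smul _ _

section Sugawara

variable (M : Type) [AddCommGroup M] [Module ℂ M]
  [Module (UniversalEnvelopingAlgebra ℂ AffineSl2) M]
  [IsScalarTower ℂ (UniversalEnvelopingAlgebra ℂ AffineSl2) M]

/-- The operator by which `xₙ` acts on a module over the affine Lie algebra. -/
abbrev modeAct (x : Sl2) (n : ℤ) : Module.End ℂ M := act AffineSl2 M (mode x n)

/-- A module over the affine Lie algebra has level `k` if `K` acts by `k`. -/
def HasLevel (k : ℂ) : Prop := act AffineSl2 M centralK = k • 1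

/-- The operator `2 (e₋ₙ₋₁ fₙ - f₋ₙ₋₁ eₙ)`, of which the commutators of `h₋₁` with the terms of the
Sugawara operator are differences. -/
def sugawaraShift (n : ℤ) : Module.End ℂ M :=
  (2 : ℂ) • (modeAct M sl2E (-n - 1) * modeAct M sl2F n -
    modeAct M sl2F (-n - 1) * modeAct M sl2E n)

/-- The Sugawara operator without its scalar factor, with the sum restricted to `n ≤ N`. -/
def partialSugawara (N : ℕ) : Module.End ℂ M :=
  sugawaraTerm M 0 + (2 : ℂ) • ∑ n ∈ Finset.range N, sugawaraTerm M (n + 1)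

variable {M}

theorem modeAct_add (x y : Sl2) (n : ℤ) :
    modeAct M (x + y) n = modeAct M x n + modeAct M y n := by
  rw [modeAct, mode_add]
  exact (actHom AffineSl2 M).map_add _ _

theorem modeAct_smul (a : ℂ) (x : Sl2) (n : ℤ) : modeAct M (a • x) n = a • modeAct M x n := by
  rw [modeAct, mode_smul]
  exact (actHom AffineSl2 M).map_smul _ _

theorem modeAct_zero (n : ℤ) : modeAct M 0 n = 0 := by
  simpa using modeAct_smul (M := M) 0 0 n

theorem HasLevel.lie_modeAct {k : ℂ} (hM : HasLevel M k) (x y : Sl2) (m n : ℤ) :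
    ⁅modeAct M x m, modeAct M y n⁆ = modeAct M ⁅x, y⁆ (m + n) +
      ((if m + n = 0 then (m : ℂ) * Matrix.trace (x.1 * y.1) else 0) * k) • 1 := by
  rw [← act_lie, lie_mode_mode, mul_smul, ← show _ = k • (1 : Module.End ℂ M) from hM,
    ← actHom_apply, map_add, map_smul, actHom_apply, actHom_apply]

theorem lie_modeAct_zero (x y : Sl2) (n : ℤ) :
    ⁅modeAct M x 0, modeAct M y n⁆ = modeAct M ⁅x, y⁆ n := by
  rw [← act_lie, lie_mode_mode, Int.cast_zero, zero_mul, ite_self, zero_smul, add_zero, zero_add]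

theorem HasLevel.lie_H_E {k : ℂ} (hM : HasLevel M k) (m n : ℤ) :
    ⁅modeAct M sl2H m, modeAct M sl2E n⁆ = (2 : ℂ) • modeAct M sl2E (m + n) := by
  rw [hM.lie_modeAct, sl2_trace_H_E, mul_zero, ite_self, zero_mul, zero_smul, add_zero,
    sl2_lie_H_E, modeAct_smul]

theorem HasLevel.lie_H_F {k : ℂ} (hM : HasLevel M k) (m n : ℤ) :
    ⁅modeAct M sl2H m, modeAct M sl2F n⁆ = (-2 : ℂ) • modeAct M sl2F (m + n) := by
  rw [hM.lie_modeAct, sl2_trace_H_F, mul_zero, ite_self, zero_mul, zero_smul, add_zero,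
    sl2_lie_H_F, modeAct_smul]

theorem HasLevel.lie_H_H {k : ℂ} (hM : HasLevel M k) (m n : ℤ) :
    ⁅modeAct M sl2H m, modeAct M sl2H n⁆ = (if m + n = 0 then 2 * (m : ℂ) * k else 0) • 1 := by
  rw [hM.lie_modeAct, sl2_trace_H_H, lie_self, modeAct_zero, zero_add]
  split_ifs <;> ring_nf

theorem lie_E_zero_F (n : ℤ) : ⁅modeAct M sl2E 0, modeAct M sl2F n⁆ = modeAct M sl2H n := by
  rw [lie_modeAct_zero, sl2_lie_E_F]

theorem lie_F_zero_E (n : ℤ) : ⁅modeAct M sl2F 0, modeAct M sl2E n⁆ = -modeAct M sl2H n := by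
  rw [lie_modeAct_zero, ← lie_skew, sl2_lie_E_F, ← neg_one_smul ℂ, modeAct_smul, neg_one_smul]

theorem sl2_induction {P : Sl2 → Prop} (hE : P sl2E) (hH : P sl2H) (hF : P sl2F)
    (hadd : ∀ x y, P x → P y → P (x + y)) (hsmul : ∀ (a : ℂ) x, P x → P (a • x)) (x : Sl2) :
    P x := by
  rw [sl2_eq_sum x]
  exact hadd _ _ (hadd _ _ (hsmul _ _ hE) (hsmul _ _ hH)) (hsmul _ _ hF)

theorem lie_modeAct_zero_sugawaraTerm (x : Sl2) (n : ℕ) :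
    ⁅modeAct M x 0, sugawaraTerm M n⁆ = 0 := by
  have hEH : ⁅sl2E, sl2H⁆ = (-2 : ℂ) • sl2E := by
    rw [← lie_skew, sl2_lie_H_E, neg_smul]
  have hFE : ⁅sl2F, sl2E⁆ = (-1 : ℂ) • sl2H := by
    rw [← lie_skew, sl2_lie_E_F, neg_one_smul]
  have hFH : ⁅sl2F, sl2H⁆ = (2 : ℂ) • sl2F := by
    rw [← lie_skew, sl2_lie_H_F, neg_smul, neg_neg]
  induction x using sl2_induction with
  | hE =>
    simp only [sugawaraTerm, lie_add, lie_smul, lie_mul_eq, lie_modeAct_zero, hEH, sl2_lie_E_F,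
      lie_self, modeAct_zero, modeAct_smul, zero_mul, mul_zero, smul_mul_assoc, mul_smul_comm]
    module
  | hH =>
    simp only [sugawaraTerm, lie_add, lie_smul, lie_mul_eq, lie_modeAct_zero, sl2_lie_H_E,
      sl2_lie_H_F, lie_self, modeAct_zero, modeAct_smul, zero_mul, mul_zero, smul_mul_assoc,
      mul_smul_comm]
    module
  | hF =>
    simp only [sugawaraTerm, lie_add, lie_smul, lie_mul_eq, lie_modeAct_zero, hFE, hFH,
      lie_self, modeAct_zero, modeAct_smul, zero_mul, mul_zero, smul_mul_assoc, mul_smul_comm]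
    module
  | hadd x y hx hy => rw [modeAct_add, add_lie, hx, hy, add_zero]
  | hsmul a x hx => rw [modeAct_smul, smul_lie, hx, smul_zero]

theorem lie_modeAct_zero_partialSugawara (x : Sl2) (N : ℕ) :
    ⁅modeAct M x 0, partialSugawara M N⁆ = 0 := by
  simp only [partialSugawara, lie_add, lie_smul, lie_sum, lie_modeAct_zero_sugawaraTerm,
    Finset.sum_const_zero, smul_zero, add_zero]

theorem HasLevel.lie_H_sugawaraTerm {k : ℂ} (hM : HasLevel M k) (n : ℕ) :
    ⁅modeAct M sl2H (-1), sugawaraTerm M n⁆ =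
      sugawaraShift M n - sugawaraShift M (n - 1) -
        (if n = 1 then k else 0) • modeAct M sl2H (-1) := by
  have hHH : ⁅modeAct M sl2H (-1), modeAct M sl2H (-n)⁆ = 0 := by
    rw [hM.lie_H_H, if_neg (by omega), zero_smul]
  have hHH' : modeAct M sl2H (-n) * ⁅modeAct M sl2H (-1), modeAct M sl2H n⁆ =
      (-2 * if n = 1 then k else 0) • modeAct M sl2H (-1) := by
    rw [hM.lie_H_H, mul_smul_comm, mul_one]
    rcases eq_or_ne n 1 with rfl | hn
    · simp
    · rw [if_neg (by omega), if_neg hn, mul_zero, zero_smul, zero_smul]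
  simp only [sugawaraTerm, sugawaraShift, lie_add, lie_smul, lie_mul_eq, hHH, hHH', hM.lie_H_E,
    hM.lie_H_F, neg_sub, sub_sub_cancel_left, zero_mul, zero_add, smul_mul_assoc, mul_smul_comm,
    neg_add_eq_sub (1 : ℤ)]
  module

theorem sugawaraShift_neg_one : sugawaraShift M (-1) =
    (4 : ℂ) • modeAct M sl2H (-1) - sugawaraShift M 0 := by
  have hEF := lie_E_zero_F (M := M) (-1)
  have hFE := lie_F_zero_E (M := M) (-1)
  rw [Ring.lie_def, sub_eq_iff_eq_add] at hEF hFE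
  simp only [sugawaraShift, neg_neg, sub_self, neg_zero, zero_sub, hEF, hFE]
  module

theorem HasLevel.lie_H_partialSugawara {k : ℂ} (hM : HasLevel M k) (N : ℕ) :
    ⁅modeAct M sl2H (-1), partialSugawara M (N + 1)⁆ =
      (2 : ℂ) • sugawaraShift M (N + 1) - (2 * (k + 2)) • modeAct M sl2H (-1) := by
  have hterm (n : ℕ) := hM.lie_H_sugawaraTerm (n + 1)
  have htele (n : ℕ) : ⁅modeAct M sl2H (-1), ∑ m ∈ Finset.range (n + 1), sugawaraTerm M (m + 1)⁆ =
      sugawaraShift M (n + 1) - sugawaraShift M 0 - k • modeAct M sl2H (-1) := by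
    induction n with
    | zero => simp [hterm]
    | succ n ih =>
      rw [Finset.sum_range_succ, lie_add, ih, hterm, if_neg (by omega), zero_smul, sub_zero]
      push_cast
      rw [add_sub_cancel_right]
      abel
  have hzero := hM.lie_H_sugawaraTerm 0
  rw [if_neg zero_ne_one, zero_smul, sub_zero, Nat.cast_zero, zero_sub, sugawaraShift_neg_one]
    at hzero
  rw [partialSugawara, lie_add, lie_smul, htele, hzero]
  module

open Filter

variable [IsSmooth M]

theorem eventually_modeAct_eq_zero (x : Sl2) (v : M) :
    ∀ᶠ n : ℕ in atTop, modeAct M x n v = 0 :=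
  eventually_atTop.2 (IsSmooth.eventually_zero x v)

theorem eventually_sugawaraShift_eq_zero (v : M) :
    ∀ᶠ n : ℕ in atTop, sugawaraShift M n v = 0 := by
  filter_upwards [eventually_modeAct_eq_zero sl2E v, eventually_modeAct_eq_zero sl2F v]
    with n hE hF
  simp only [sugawaraShift, LinearMap.smul_apply, LinearMap.sub_apply, Module.End.mul_apply, hE, hF,
    map_zero, sub_zero, smul_zero]

theorem eventually_sugawaraL0_eq (k : ℂ) (v : M) : ∀ᶠ N : ℕ in atTop,
    sugawaraL0 k M v = (1 / (2 * (k + 2))) • partialSugawara M N v := by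
  obtain ⟨N₀, hN₀⟩ := (sugawaraTerm_finite M v).bddAbove
  filter_upwards [eventually_gt_atTop N₀] with N hN
  have hsum : ∑ᶠ n : ℕ, sugawaraTerm M (n + 1) v =
      ∑ n ∈ Finset.range N, sugawaraTerm M (n + 1) v :=
    finsum_eq_sum_of_support_subset _ fun n hn =>
      Finset.mem_coe.2 (Finset.mem_range.2 ((hN₀ hn).trans_lt hN))
  change (1 / (2 * (k + 2))) • (sugawaraTerm M 0 v + (2 : ℂ) • ∑ᶠ n, sugawaraTerm M (n + 1) v) = _
  rw [hsum, partialSugawara, LinearMap.add_apply, LinearMap.smul_apply, LinearMap.sum_apply]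

theorem eventually_lie_sugawaraL0_eq (k : ℂ) (d : Module.End ℂ M) (v : M) : ∀ᶠ N : ℕ in atTop,
    ⁅d, sugawaraL0 k M⁆ v = (1 / (2 * (k + 2))) • ⁅d, partialSugawara M N⁆ v := by
  filter_upwards [eventually_sugawaraL0_eq k v, eventually_sugawaraL0_eq k (d v)] with N hv hdv
  simp only [Ring.lie_def, LinearMap.sub_apply, Module.End.mul_apply, hv, hdv, map_smul, smul_sub]

theorem lie_sugawaraL0_modeAct_zero (k : ℂ) (x : Sl2) :
    ⁅sugawaraL0 k M, modeAct M x 0⁆ = 0 := by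
  rw [← lie_skew, neg_eq_zero]
  refine LinearMap.ext fun v => ?_
  obtain ⟨N, hN⟩ := (eventually_lie_sugawaraL0_eq k (modeAct M x 0) v).exists
  rw [hN, lie_modeAct_zero_partialSugawara, LinearMap.zero_apply, smul_zero]

theorem HasLevel.lie_sugawaraL0_H {k : ℂ} (hM : HasLevel M k) (hk : k ≠ -2) :
    ⁅sugawaraL0 k M, modeAct M sl2H (-1)⁆ = modeAct M sl2H (-1) := by
  have hk' : 2 * (k + 2) ≠ 0 :=
    mul_ne_zero two_ne_zero fun h => hk (eq_neg_of_add_eq_zero_left h)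
  rw [← lie_skew, neg_eq_iff_eq_neg]
  refine LinearMap.ext fun v => ?_
  obtain ⟨N, hN, hshift⟩ := ((tendsto_add_atTop_nat 1).eventually
    ((eventually_lie_sugawaraL0_eq k (modeAct M sl2H (-1)) v).and
      (eventually_sugawaraShift_eq_zero v))).exists
  rw [Nat.cast_succ] at hshift
  rw [hN, hM.lie_H_partialSugawara, LinearMap.sub_apply, LinearMap.smul_apply, hshift, smul_zero,
    zero_sub, LinearMap.smul_apply, smul_neg, smul_smul, one_div, inv_mul_cancel₀ hk', one_smul,
    LinearMap.neg_apply]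

theorem HasLevel.lie_sugawaraL0_modeAct {k : ℂ} (hM : HasLevel M k) (hk : k ≠ -2) (x : Sl2)
    (n : ℕ) : ⁅sugawaraL0 k M, modeAct M x (-n)⁆ = (n : ℂ) • modeAct M x (-n) := by
  induction n generalizing x with
  | zero => simp [lie_sugawaraL0_modeAct_zero]
  | succ n ih =>
    have hn : -((n + 1 : ℕ) : ℤ) = -1 + -n := by omega
    have hH : ⁅sugawaraL0 k M, modeAct M sl2H (-1)⁆ = (1 : ℂ) • modeAct M sl2H (-1) := by
      rw [hM.lie_sugawaraL0_H hk, one_smul]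
    have hE : ⁅sugawaraL0 k M, modeAct M sl2E (-1 + -n)⁆ =
        ((n + 1 : ℕ) : ℂ) • modeAct M sl2E (-1 + -n) := by
      have h := lie_lie_eq_smul hH (ih sl2E)
      rw [hM.lie_H_E, lie_smul, smul_comm] at h
      rw [Nat.cast_succ, add_comm (n : ℂ)]
      exact smul_right_injective _ two_ne_zero h
    have hF : ⁅sugawaraL0 k M, modeAct M sl2F (-1 + -n)⁆ =
        ((n + 1 : ℕ) : ℂ) • modeAct M sl2F (-1 + -n) := by
      have h := lie_lie_eq_smul hH (ih sl2F)
      rw [hM.lie_H_F, lie_smul, smul_comm] at h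
      rw [Nat.cast_succ, add_comm (n : ℂ)]
      exact smul_right_injective _ (neg_ne_zero.2 two_ne_zero) h
    rw [hn]
    induction x using sl2_induction with
    | hE => exact hE
    | hF => exact hF
    | hH =>
      have hE₀ : ⁅sugawaraL0 k M, modeAct M sl2E 0⁆ = (0 : ℂ) • modeAct M sl2E 0 := by
        rw [lie_sugawaraL0_modeAct_zero, zero_smul]
      have h := lie_lie_eq_smul hE₀ hF
      rwa [lie_E_zero_F, zero_add] at h
    | hadd x y hx hy => rw [modeAct_add, lie_add, hx, hy, smul_add]
    | hsmul a x hx => rw [modeAct_smul, lie_smul, hx, smul_comm]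

end Sugawara

namespace Borel

variable (b : Borel) (k ν : ℂ)

/-- The `L₀`-weight of the generator of a Verma module. -/
def conformalWeight : ℂ := (b.sign * ν + ν ^ 2 / 2) / (2 * (k + 2))

theorem hasLevel : HasLevel (CyclicModule (b.relations k ν)) k :=
  (b.isInduced k ν).act_eq_smul_one_of_central centralK_lie centralK_mem_relations

theorem sugawaraTerm_zero_eq (M : Type) [AddCommGroup M] [Module ℂ M]
    [Module (UniversalEnvelopingAlgebra ℂ AffineSl2) M]
    [IsScalarTower ℂ (UniversalEnvelopingAlgebra ℂ AffineSl2) M] :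
    sugawaraTerm M 0 = (2 : ℂ) • (modeAct M b.lowering 0 * modeAct M b.raising 0) +
      b.sign • modeAct M sl2H 0 + (1 / 2 : ℂ) • modeAct M sl2H 0 ^ 2 := by
  have hsum : modeAct M sl2E 0 * modeAct M sl2F 0 + modeAct M sl2F 0 * modeAct M sl2E 0 =
      modeAct M b.raising 0 * modeAct M b.lowering 0 +
        modeAct M b.lowering 0 * modeAct M b.raising 0 := by
    cases b
    exacts [rfl, add_comm _ _]
  have hcomm := lie_modeAct_zero (M := M) b.raising b.lowering 0
  rw [lie_raising_lowering, modeAct_smul, Ring.lie_def, sub_eq_iff_eq_add] at hcomm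
  rw [sugawaraTerm, Nat.cast_zero, neg_zero, hsum, hcomm, sq]
  module

theorem sugawaraL0_gen :
    sugawaraL0 k (CyclicModule (b.relations k ν)) (CyclicModule.gen _) =
      b.conformalWeight k ν • CyclicModule.gen _ := by
  set M := CyclicModule (b.relations k ν)
  set v : M := CyclicModule.gen _
  have hpos (x : Sl2) (n : ℕ) : modeAct M x (n + 1) v = 0 :=
    (act_gen (positive_mem_relations x n)).trans (zero_smul _ _)
  have hterm (n : ℕ) : sugawaraTerm M (n + 1) v = 0 := by
    simp only [sugawaraTerm, LinearMap.add_apply, LinearMap.smul_apply, Module.End.mul_apply,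
      Nat.cast_succ, hpos, map_zero, smul_zero, add_zero]
  have hcartan : modeAct M sl2H 0 v = ν • v := act_gen cartan_mem_relations
  have hraising : modeAct M b.raising 0 v = 0 :=
    (act_gen raising_mem_relations).trans (zero_smul _ _)
  have hzero : sugawaraTerm M 0 v = (b.sign * ν + ν ^ 2 / 2) • v := by
    simp only [b.sugawaraTerm_zero_eq, LinearMap.add_apply, LinearMap.smul_apply, sq,
      Module.End.mul_apply, hcartan, hraising, map_zero, map_smul]
    module
  obtain ⟨N, hN⟩ := (eventually_sugawaraL0_eq k v).exists
  rw [hN, partialSugawara, LinearMap.add_apply, LinearMap.smul_apply, LinearMap.sum_apply, hzero,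
    Finset.sum_congr rfl fun n _ => hterm n, Finset.sum_const_zero, smul_zero, add_zero, smul_smul,
    conformalWeight, one_div_mul_eq_div]

theorem cartan_basis (p : Exponents) :
    act AffineSl2 (CyclicModule (b.relations k ν)) (mode sl2H 0) (b.basis k ν p) =
      (p.weight b.cartanWeight + ν) • b.basis k ν p := by
  refine (b.isInduced k ν).apply_exponentBasis (fun a => ?_) (act_gen cartan_mem_relations) p
  exact (lie_modeAct_zero _ _ _).trans (by rw [lie_H_rootVector, modeAct_smul]; rfl)

theorem sugawaraL0_basis (hk : k ≠ -2) (p : Exponents) :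
    sugawaraL0 k (CyclicModule (b.relations k ν)) (b.basis k ν p) =
      (p.weight (fun a => a.modeNumber) + b.conformalWeight k ν) • b.basis k ν p :=
  (b.isInduced k ν).apply_exponentBasis
    (fun a => (b.hasLevel k ν).lie_sugawaraL0_modeAct hk (b.rootVector a) a.modeNumber)
    (b.sugawaraL0_gen k ν) p

end Borel

end Commutators

section Eigenbasis

variable {K V ι : Type*} [Field K] [AddCommGroup V] [Module K V] (b : Module.Basis ι K V)

open Submodule

theorem mem_span_image_basis_iff {s : Set ι} {v : V} :
    v ∈ span K (b '' s) ↔ ∀ i, b.repr v i ≠ 0 → i ∈ s := by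
  simp only [b.mem_span_image, Set.subset_def, Finset.mem_coe, Finsupp.mem_support_iff]

theorem span_image_basis_inf (s t : Set ι) :
    span K (b '' s) ⊓ span K (b '' t) = span K (b '' (s ∩ t)) := by
  ext v
  simp only [mem_inf, mem_span_image_basis_iff, Set.mem_inter_iff, ← forall_and]

theorem iSup_span_image_fiber_eq_top {κ : Type*} (w : ι → κ) :
    ⨆ q, span K (b '' (w ⁻¹' {q})) = ⊤ := by
  rw [← span_iUnion, ← Set.image_iUnion, ← Set.preimage_iUnion, Set.iUnion_of_singleton,
    Set.preimage_univ, Set.image_univ, b.span_eq]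

theorem finrank_span_image_basis (s : Set ι) :
    Module.finrank K (span K (b '' s)) = s.ncard := by
  rw [Set.image_eq_range]
  exact Module.finrank_eq_nat_card_basis
    (Module.Basis.span (b.linearIndependent.comp _ Subtype.val_injective))

theorem eigenspace_eq_span_image {d : Module.End K V} {w : ι → K} (hd : ∀ i, d (b i) = w i • b i)
    (c : K) : d.eigenspace c = span K (b '' (w ⁻¹' {c})) := by
  have hrepr (v : V) (i : ι) : b.repr (d v) i = w i * b.repr v i := by
    refine LinearMap.congr_fun (f := b.coord i ∘ₗ d) (g := w i • b.coord i) (b.ext fun j => ?_) v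
    rcases eq_or_ne j i with rfl | hji
    · simp [hd]
    · simp [hd, hji]
  ext v
  rw [Module.End.mem_eigenspace_iff, mem_span_image_basis_iff, ← b.repr.injective.eq_iff,
    Finsupp.ext_iff]
  refine forall_congr' fun i => ?_
  rw [hrepr, map_smul, Finsupp.smul_apply, smul_eq_mul, mul_eq_mul_right_iff, or_iff_not_imp_right]
  rfl

theorem eigenspace_inf_eigenspace_eq_span_image {d d' : Module.End K V} {w w' : ι → K}
    (hd : ∀ i, d (b i) = w i • b i) (hd' : ∀ i, d' (b i) = w' i • b i) (c c' : K) :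
    d.eigenspace c ⊓ d'.eigenspace c' =
      span K (b '' ((fun i => (w i, w' i)) ⁻¹' {(c, c')})) := by
  rw [eigenspace_eq_span_image b hd, eigenspace_eq_span_image b hd', span_image_basis_inf]
  congr 2
  ext i
  exact Prod.mk_inj.symm

end Eigenbasis

section Substitution

variable {ι : Type*} {w : ι → ℂ × ℂ} {a b : ℂ}

theorem canSubstitute_ncard_fiber (hfin : ∀ m, {i | a * (w i).1 + b * (w i).2 = m}.Finite) :
    CanSubstitute (fun f n => (w ⁻¹' {(f, n)}).ncard) a b := by
  refine fun m => ((hfin m).image w).subset ?_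
  rintro q ⟨hq, hne⟩
  obtain ⟨i, hi⟩ := Set.nonempty_of_ncard_ne_zero hne
  obtain rfl : w i = q := hi
  exact ⟨i, hq, rfl⟩

theorem finsum_ncard_fiber {κ : Type*} (w : ι → κ) {s : Set ι} (hs : s.Finite) :
    ∑ᶠ q, (s ∩ w ⁻¹' {q}).ncard = s.ncard := by
  classical
  have hfiber (q : κ) : (s ∩ w ⁻¹' {q}).ncard = (hs.toFinset.filter fun i => w i = q).card := by
    rw [← Set.ncard_coe_finset, Finset.coe_filter]
    congr 1
    ext i
    simp
  rw [Set.ncard_eq_toFinset_card s hs, Finset.card_eq_sum_card_image w, finsum_congr hfiber]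
  refine finsum_eq_sum_of_support_subset _ fun q hq => ?_
  obtain ⟨i, hi⟩ := Finset.card_ne_zero.1 hq
  obtain ⟨his, hiq⟩ := Finset.mem_filter.1 hi
  exact Finset.mem_coe.2 (Finset.mem_image.2 ⟨i, his, hiq⟩)

theorem substitute_ncard_fiber (hfin : ∀ m, {i | a * (w i).1 + b * (w i).2 = m}.Finite) (m : ℂ) :
    substitute (fun f n => (w ⁻¹' {(f, n)}).ncard) a b m =
      {i | a * (w i).1 + b * (w i).2 = m}.ncard := by
  classical
  rw [← finsum_ncard_fiber w (hfin m), substitute]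
  refine finsum_congr fun q => ?_
  rw [finsum_eq_if]
  split_ifs with hq
  · congr 1
    refine (Set.inter_eq_right.2 ?_).symm
    intro i hi
    obtain rfl : w i = q := hi
    exact hq
  · symm
    rw [Set.ncard_eq_zero ((hfin m).inter_of_left _), Set.eq_empty_iff_forall_notMem]
    rintro i ⟨him, rfl⟩
    exact hq him

end Substitution

namespace Exponents

theorem finite_degree_add_eq (h m : ℂ) : {p : Exponents | p.degree + h = m}.Finite := by
  rcases {p : Exponents | p.degree + h = m}.eq_empty_or_nonempty with hempty | ⟨p₀, rfl⟩
  · exact hempty ▸ Set.finite_empty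
  · exact (finite_degree_eq p₀.degree).subset fun p hp => Nat.cast_injective (add_right_cancel hp)

end Exponents

namespace Virasoro

variable (c h : ℂ)

theorem weightSpace_eq_span (m : ℂ) : virasoroWeightSpace (VirasoroVerma c h) m =
    Submodule.span ℂ (basis c h '' {p | p.degree + h = m}) :=
  eigenspace_eq_span_image _ (act_L_zero_basis c h) m

theorem hasVirasoroCharacter : HasVirasoroCharacter (VirasoroVerma c h) := by
  refine ⟨?_, fun m => ?_⟩
  · simp only [weightSpace_eq_span]
    exact iSup_span_image_fiber_eq_top _ _
  · rw [weightSpace_eq_span]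
    exact FiniteDimensional.span_of_finite ℂ ((Exponents.finite_degree_add_eq h m).image _)

theorem virasoroCharacter_apply (m : ℂ) :
    virasoroCharacter (VirasoroVerma c h) m = {p : Exponents | p.degree + h = m}.ncard := by
  rw [virasoroCharacter, weightSpace_eq_span, finrank_span_image_basis]

end Virasoro

namespace Borel

variable (b : Borel) (k ν c : ℂ) {h : ℂ}

/-- The exponent `a` of the substitution `w ↦ q^a`, `q ↦ q³` that turns the character of a Verma
module over the affine Lie algebra into that of a Verma module over the Virasoro algebra. -/
def slope : Borel → ℂ
  | highest => -1 / 2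
  | lowest => 1 / 2

/-- The `(h₀, L₀)`-weight of a monomial applied to the generator of a Verma module. -/
def jointWeight (p : Exponents) : ℂ × ℂ :=
  (p.weight b.cartanWeight + ν, p.weight (fun a => a.modeNumber) + b.conformalWeight k ν)

theorem degree_factor (a : Factor) :
    (a.degree : ℂ) = b.slope * b.cartanWeight a + 3 * a.modeNumber := by
  cases b <;> cases a <;>
    simp [slope, cartanWeight, sign, Factor.degree, Factor.modeNumber] <;> ring

theorem degree_add (p : Exponents) :
    p.degree + (b.slope * ν + 3 * b.conformalWeight k ν) =
      b.slope * (b.jointWeight k ν p).1 + 3 * (b.jointWeight k ν p).2 := by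
  have hdegree : (p.degree : ℂ) =
      b.slope * p.weight b.cartanWeight + 3 * p.weight (fun a => a.modeNumber) := by
    simp only [← p.weight_degree, Exponents.weight, b.degree_factor, Multiset.sum_map_add,
      Multiset.sum_map_mul_left]
  rw [hdegree, jointWeight]
  ring

theorem setOf_jointWeight_eq (m : ℂ) :
    {p | b.slope * (b.jointWeight k ν p).1 + 3 * (b.jointWeight k ν p).2 = m} =
      {p : Exponents | p.degree + (b.slope * ν + 3 * b.conformalWeight k ν) = m} := by
  simp only [b.degree_add]

theorem finite_jointWeight_eq (m : ℂ) :
    {p | b.slope * (b.jointWeight k ν p).1 + 3 * (b.jointWeight k ν p).2 = m}.Finite :=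
  b.setOf_jointWeight_eq k ν m ▸ Exponents.finite_degree_add_eq _ m

variable {k}

theorem slope_mul_add_conformalWeight (μ : ℂ) (hk : k ≠ -2) :
    b.slope * (b.sign * μ) + 3 * b.conformalWeight k (b.sign * μ) =
      μ * (3 * μ + 2 - 2 * k) / (4 * (k + 2)) := by
  have hk' : k + 2 ≠ 0 := fun h => hk (eq_neg_of_add_eq_zero_left h)
  cases b <;> rw [conformalWeight, slope, sign] <;> field_simp <;> ring

theorem weightSpace_eq_span (hk : k ≠ -2) (f n : ℂ) :
    affineWeightSpace k (CyclicModule (b.relations k ν)) f n =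
      Submodule.span ℂ (b.basis k ν '' (b.jointWeight k ν ⁻¹' {(f, n)})) :=
  eigenspace_inf_eigenspace_eq_span_image _ (b.cartan_basis k ν) (b.sugawaraL0_basis k ν hk) f n

theorem hasAffineCharacter (hk : k ≠ -2) :
    HasAffineCharacter k (CyclicModule (b.relations k ν)) := by
  refine ⟨?_, fun f n => ?_⟩
  · simp only [b.weightSpace_eq_span ν hk]
    exact iSup_span_image_fiber_eq_top _ _
  · rw [b.weightSpace_eq_span ν hk]
    refine FiniteDimensional.span_of_finite ℂ (Set.Finite.image _ ?_)
    exact (b.finite_jointWeight_eq k ν _).subset fun p hp => congrArg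
      (fun q : ℂ × ℂ => b.slope * q.1 + 3 * q.2) hp

theorem affineCharacter_eq (hk : k ≠ -2) :
    affineCharacter k (CyclicModule (b.relations k ν)) =
      fun f n => (b.jointWeight k ν ⁻¹' {(f, n)}).ncard := by
  funext f n
  rw [affineCharacter, b.weightSpace_eq_span ν hk, finrank_span_image_basis]

theorem canSubstitute_affineCharacter (hk : k ≠ -2) :
    CanSubstitute (affineCharacter k (CyclicModule (b.relations k ν))) b.slope 3 := by
  rw [b.affineCharacter_eq ν hk]
  exact canSubstitute_ncard_fiber (b.finite_jointWeight_eq k ν)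

theorem substitute_affineCharacter (hk : k ≠ -2)
    (hh : h = b.slope * ν + 3 * b.conformalWeight k ν) :
    substitute (affineCharacter k (CyclicModule (b.relations k ν))) b.slope 3 =
      virasoroCharacter (VirasoroVerma c h) := by
  funext m
  rw [b.affineCharacter_eq ν hk, substitute_ncard_fiber (b.finite_jointWeight_eq k ν),
    b.setOf_jointWeight_eq, Virasoro.virasoroCharacter_apply, hh]

variable (k h)

/-- The isomorphism `φ⁺` or `φ⁻` onto a Verma module over the Virasoro algebra, which matches the
bases of monomials. -/
def equivVirasoro : CyclicModule (b.relations k ν) ≃ₗ[ℂ] VirasoroVerma c h :=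
  (b.basis k ν).equiv (Virasoro.basis c h) (Equiv.refl Exponents)

theorem equivVirasoro_basis (p : Exponents) :
    b.equivVirasoro k ν c h (b.basis k ν p) = virasoroMonomial c h p := by
  rw [equivVirasoro, Module.Basis.equiv_apply, Equiv.refl_apply, Virasoro.basis_apply]

variable {k h}

theorem equivVirasoro_mem_weightSpace (hk : k ≠ -2)
    (hh : h = b.slope * ν + 3 * b.conformalWeight k ν) {f n : ℂ}
    {v : CyclicModule (b.relations k ν)}
    (hv : v ∈ affineWeightSpace k (CyclicModule (b.relations k ν)) f n) :
    b.equivVirasoro k ν c h v ∈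
      virasoroWeightSpace (VirasoroVerma c h) (b.slope * f + 3 * n) := by
  rw [b.weightSpace_eq_span ν hk] at hv
  have hmap := Submodule.mem_map_of_mem (f := (b.equivVirasoro k ν c h).toLinearMap) hv
  rw [Submodule.map_span] at hmap
  rw [Virasoro.weightSpace_eq_span]
  refine Submodule.span_mono ?_ hmap
  rintro _ ⟨_, ⟨p, hp, rfl⟩, rfl⟩
  refine ⟨p, ?_, (Virasoro.basis_apply c h p).trans (b.equivVirasoro_basis k ν c h p).symm⟩
  rw [Set.mem_ofPred_eq, hh, b.degree_add, show b.jointWeight k ν p = (f, n) from hp]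

end Borel

end AffVir

end

theorem mainTheorem3 (k μ c h : ℂ) (hk : k ≠ -2)
    (hh : h = μ * (3 * μ + 2 - 2 * k) / (4 * (k + 2))) :
    -- the map `φ⁺` on the highest-weight Verma module `M_k(μ)`
    (∃ b : Module.Basis AffVir.Exponents ℂ (AffVir.AffineVerma k μ),
      (∀ p, b p = AffVir.affineMonomial k μ p) ∧
      ∃ φ : AffVir.AffineVerma k μ ≃ₗ[ℂ] AffVir.VirasoroVerma c h,
        (∀ p, φ (b p) = AffVir.virasoroMonomial c h p) ∧
        ∀ (f n : ℂ), ∀ x ∈ AffVir.affineWeightSpace k (AffVir.AffineVerma k μ) f n,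
          φ x ∈ AffVir.virasoroWeightSpace (AffVir.VirasoroVerma c h) (-f / 2 + 3 * n)) ∧
    -- the map `φ⁻` on the lowest-weight Verma module `M⁻_k(-μ)`
    (∃ b : Module.Basis AffVir.Exponents ℂ (AffVir.AffineVermaLowest k (-μ)),
      (∀ p, b p = AffVir.affineMonomialLowest k (-μ) p) ∧
      ∃ φ : AffVir.AffineVermaLowest k (-μ) ≃ₗ[ℂ] AffVir.VirasoroVerma c h,
        (∀ p, φ (b p) = AffVir.virasoroMonomial c h p) ∧
        ∀ (f n : ℂ), ∀ x ∈ AffVir.affineWeightSpace k (AffVir.AffineVermaLowest k (-μ)) f n,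
          φ x ∈ AffVir.virasoroWeightSpace (AffVir.VirasoroVerma c h) (f / 2 + 3 * n)) ∧
    -- the formal characters are defined
    AffVir.HasAffineCharacter k (AffVir.AffineVerma k μ) ∧
    AffVir.HasAffineCharacter k (AffVir.AffineVermaLowest k (-μ)) ∧
    AffVir.HasVirasoroCharacter (AffVir.VirasoroVerma c h) ∧
    -- the character identity for `M_k(μ)`
    (AffVir.CanSubstitute (AffVir.affineCharacter k (AffVir.AffineVerma k μ)) (-1 / 2) 3 ∧
      AffVir.substitute (AffVir.affineCharacter k (AffVir.AffineVerma k μ)) (-1 / 2) 3 =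
        AffVir.virasoroCharacter (AffVir.VirasoroVerma c h)) ∧
    -- the character identity for `M⁻_k(-μ)`
    (AffVir.CanSubstitute (AffVir.affineCharacter k (AffVir.AffineVermaLowest k (-μ))) (1 / 2) 3 ∧
      AffVir.substitute (AffVir.affineCharacter k (AffVir.AffineVermaLowest k (-μ))) (1 / 2) 3 =
        AffVir.virasoroCharacter (AffVir.VirasoroVerma c h)) := by
  have hhighest : h = AffVir.Borel.highest.slope * μ +
      3 * AffVir.Borel.highest.conformalWeight k μ := by
    simpa [AffVir.Borel.sign] using
      hh.trans (AffVir.Borel.highest.slope_mul_add_conformalWeight μ hk).symm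
  have hlowest : h = AffVir.Borel.lowest.slope * (-μ) +
      3 * AffVir.Borel.lowest.conformalWeight k (-μ) := by
    simpa [AffVir.Borel.sign] using
      hh.trans (AffVir.Borel.lowest.slope_mul_add_conformalWeight μ hk).symm
  refine ⟨⟨_, AffVir.Borel.basis_highest k μ, _,
      AffVir.Borel.highest.equivVirasoro_basis k μ c h, fun f n x hx => ?_⟩,
    ⟨_, AffVir.Borel.basis_lowest k (-μ), _,
      AffVir.Borel.lowest.equivVirasoro_basis k (-μ) c h, fun f n x hx => ?_⟩,
    AffVir.Borel.highest.hasAffineCharacter μ hk, AffVir.Borel.lowest.hasAffineCharacter (-μ) hk,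
    AffVir.Virasoro.hasVirasoroCharacter c h,
    ⟨AffVir.Borel.highest.canSubstitute_affineCharacter μ hk,
      AffVir.Borel.highest.substitute_affineCharacter μ c hk hhighest⟩,
    ⟨AffVir.Borel.lowest.canSubstitute_affineCharacter (-μ) hk,
      AffVir.Borel.lowest.substitute_affineCharacter (-μ) c hk hlowest⟩⟩
  · rw [show -f / 2 = -1 / 2 * f by ring]
    exact AffVir.Borel.highest.equivVirasoro_mem_weightSpace μ c hk hhighest hx
  · rw [show f / 2 = 1 / 2 * f by ring]
    exact AffVir.Borel.lowest.equivVirasoro_mem_weightSpace (-μ) c hk hlowest hx
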